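/- Let $\mathcal R$ be the space of finite point measures $\mathbf s=\sum_{i=1}^{n}\delta_{s_i}$ ($n\ge 0$, $s_i>0$) on $(0,\infty)$, with the Borel $\sigma$-algebra of weak convergence; write $\sharp\mathbf s=n$ and $\langle f,\mathbf s\rangle=\sum_i f(s_i)$, and for $c>0$ let $c\,\mathbf s=\sum_i\delta_{cs_i}$. Let $\alpha\ge 0$ and let $\nu$ be a probability measure on $\mathcal R$. Put $$\underline p=\inf\Big\{p\in\mathbb R:\int\langle x^p,\mathbf s\rangle\,\nu(d\mathbf s)<\infty\Big\},\qquad p_\infty=\inf\Big\{p>\underline p:\int\langle x^p,\mathbf s\rangle\,\nu(d\mathbf s)=\infty\Big\},$$ $$\kappa(p)=\int(1-\langle x^p,\mathbf s\rangle)\,\nu(d\mathbf s)\quad(\underline p<p<p_\infty),\qquad F(u)=\int u^{\sharp\mathbf s}\,\nu(d\mathbf s).$$ Assume: (i) $\kappa$ has a smallest zero $p_0$ in $(\underline p,p_\infty)$, $p_0>0$, $\kappa(p)>0$ for some $p\in(p_0,p_\infty)$, and $\int\langle x^{p_0},\mathbf s\rangle^{p}\,\nu(d\mathbf s)<\infty$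 for some $p>1$; (ii) $\displaystyle\int_{1-\epsilon}^{1}\frac{du}{|F(u)-u|}=\infty$ for every $\epsilon\in(0,1)$ (with $1/0=\infty$). Let $\mathcal U=\bigcup_{n\ge 0}\mathbb N^n$ be the set of nodes, $\mathbb N=\{1,2,\dots\}$. On a probability space let $((\tilde\xi_{ui})_{i\in\mathbb N},\,u\in\mathcal U)$ and $(\mathbf e_u,\,u\in\mathcal U)$ be two independent families, where the $\mathbf e_u$ are i.i.d. exponential with parameter $1$, and the sequences $(\tilde\xi_{ui})_{i}$ of nonnegative numbers, $u\in\mathcal U$, are i.i.d. with law $\nu$ (that is, almost surely there is an $n$ with $\tilde\xi_{ui}=0\Leftrightarrow i>n$, and $\sum_{i\le n}\delta_{\tilde\xi_{ui}}$ has law $\nu$). For $x>0$ define recursively $\xi_\emptyset=x$, $a_\emptyset=0$, $\xi_{ui}=\tilde\xi_{ui}\,\xi_u$, $\zeta_u=\xi_u^{-\alpha}\mathbf e_u$ and $a_{ui}=a_u+\zeta_u$; let $I_u=[a_u,a_u+\zeta_u)$ if $\xi_u>0$ and $I_u=\emptyset$ if $\xi_u=0$; and let $$\mathbf X(t)=\sum_{u\in\mathcal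 U}\mathbf 1_{\{t\in I_u\}}\,\delta_{\xi_u},\qquad t\ge 0.$$ Denote by $\mathbb P_x$ the law of $\mathbf X=(\mathbf X(t),t\ge 0)$ so obtained, and let $\mathcal F_r=\sigma(\mathbf X(r'):r'\le r)$. Then: 1. For every $x>0$, $\mathbb P_x$-almost surely, $\mathbf X(t)\in\mathcal R$ for all $t\ge 0$, and each $\mathbf X(t)$ is a random element of $\mathcal R$. 2. $\mathbf X$ is a branching Markov chain: for every $t\ge 0$ there is a Markov kernel $Q_t$ on $\mathcal R$ such that, for all $n\ge 0$ and $s_1,\dots,s_n>0$, $Q_t\big(\sum_{i=1}^n\delta_{s_i},\cdot\big)$ is the law of $\sum_{i=1}^n\mathbf X^{(i)}(t)$ with $\mathbf X^{(1)}(t),\dots,\mathbf X^{(n)}(t)$ independent and $\mathbf X^{(i)}(t)$ distributed as $\mathbf X(t)$ under $\mathbb P_{s_i}$; and for all $x>0$, $r\ge 0$ and measurable $B\subseteq\mathcal R$, $$\mathbb P_x\big(\mathbf X(t+r)\in B\mid\mathcal F_r\big)=Q_t(\mathbf X(r),B)\quad \mathbb P_x\text{-almost surely.}$$ 3. For every $c>0$,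 the law of the process $(c\,\mathbf X(c^{\alpha}t),\,t\ge 0)$ under $\mathbb P_1$ is $\mathbb P_c$ (equality of laws on $\mathcal R^{[0,\infty)}$ with the product $\sigma$-algebra). -/

import Mathlib

open MeasureTheory ProbabilityTheory
open scoped ENNReal NNReal

noncomputable section

namespace SelfSimilarBranching

/-- The half-line `(0, ∞)`. -/
abbrev PosReal : Type := {x : ℝ // 0 < x}

/-- The set of finite point measures on `(0, ∞)`, i.e. of finite sums of Dirac masses, the zero
measure included; it is closed under addition of measures. -/
def pointMeasures : AddSubmonoid (Measure PosReal) where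
  carrier := {μ | ∃ s : Multiset PosReal, μ = (s.map Measure.dirac).sum}
  zero_mem' := ⟨0, by simp⟩
  add_mem' := by
    rintro _ _ ⟨s, rfl⟩ ⟨s', rfl⟩
    exact ⟨s + s', by simp⟩

/-- The space of finite point measures on `(0, ∞)`. Its σ-algebra is the one induced from
`Measure PosReal`: it is generated by the evaluations `s ↦ s B`, `B` a Borel set, and it is the
Borel σ-algebra of the topology of weak convergence. -/
abbrev PointMeasure : Type := pointMeasures

/-- The point measure with the single atom `x`. -/
def atom (x : PosReal) : PointMeasure :=
  ⟨Measure.dirac x, {x}, by simp⟩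

open Classical in
/-- A measure, seen as a finite point measure if it is one (and replaced by `0` if not). -/
def toPointMeasure (μ : Measure PosReal) : PointMeasure :=
  if h : μ ∈ pointMeasures then ⟨μ, h⟩ else 0

/-- The point measure `c s`, whose atoms are the atoms of `s` multiplied by `c`. -/
def scale (c : PosReal) (s : PointMeasure) : PointMeasure :=
  ⟨(s : Measure PosReal).map (fun x => c * x), by
    obtain ⟨μ, l, rfl⟩ := s
    refine ⟨l.map (fun x => c * x), ?_⟩
    have hm : Measurable fun x : PosReal => c * x :=
      (measurable_const.mul measurable_subtype_coe).subtype_mk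
    induction l using Multiset.induction_on with
    | empty => simp
    | cons a l ih =>
      have hd : (Measure.dirac a).map (fun x => c * x) = Measure.dirac (c * a) := by
        rw [Measure.map_dirac' hm]
      simp only [Multiset.map_cons, Multiset.sum_cons]
      rw [Measure.map_add _ _ hm, hd]
      exact congrArg _ ih⟩

/-! ### Hypotheses on the reproduction law -/

/-- `∫ ⟨x ^ p, s⟩ ν(ds)`, in `[0, ∞]`. -/
def powerMoment (ν : Measure PointMeasure) (p : ℝ) : ℝ≥0∞ :=
  ∫⁻ s, ∫⁻ x, ENNReal.ofReal ((x : ℝ) ^ p) ∂(s : Measure PosReal) ∂ν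

/-- The infimum of the real `p` for which `∫ ⟨x ^ p, s⟩ ν(ds)` is finite. -/
def pLow (ν : Measure PointMeasure) : EReal :=
  ⨅ (p : ℝ) (_ : powerMoment ν p < ∞), (p : EReal)

/-- The infimum of the real `p > pLow ν` for which `∫ ⟨x ^ p, s⟩ ν(ds)` is infinite. -/
def pHigh (ν : Measure PointMeasure) : EReal :=
  ⨅ (p : ℝ) (_ : pLow ν < p) (_ : powerMoment ν p = ∞), (p : EReal)

/-- `κ(p) = ∫ (1 - ⟨x ^ p, s⟩) ν(ds)`, to be used for `pLow ν < p < pHigh ν`. -/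
def kappa (ν : Measure PointMeasure) (p : ℝ) : ℝ :=
  ∫ s, (1 - ∫ x, (x : ℝ) ^ p ∂(s : Measure PosReal)) ∂ν

/-- `p₀` is the Malthusian exponent: the smallest zero of `κ` on `(pLow ν, pHigh ν)`. -/
def IsMalthusianExponent (ν : Measure PointMeasure) (p₀ : ℝ) : Prop :=
  IsLeast {p : ℝ | pLow ν < p ∧ (p : EReal) < pHigh ν ∧ kappa ν p = 0} p₀

/-- The Malthusian hypotheses. -/
def MalthusianHypotheses (ν : Measure PointMeasure) : Prop :=
  ∃ p₀ : ℝ, IsMalthusianExponent ν p₀ ∧ 0 < p₀ ∧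
    (∃ p : ℝ, p₀ < p ∧ (p : EReal) < pHigh ν ∧ 0 < kappa ν p) ∧
    ∃ p : ℝ, 1 < p ∧
      ∫⁻ s, (∫⁻ x, ENNReal.ofReal ((x : ℝ) ^ p₀) ∂(s : Measure PosReal)) ^ p ∂ν < ∞

/-- `F(u) = ∫ u ^ {♯s} ν(ds)`, the generating function of the number of atoms
`♯s = s((0, ∞))`. -/
def genFun (ν : Measure PointMeasure) (u : ℝ) : ℝ :=
  ∫ s, u ^ ((s : Measure PosReal).real Set.univ) ∂ν

/-- The integral of `1 / |F(u) - u|` over `(1 - ε, 1)` is infinite for every `ε`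
(with `1 / 0 = ∞`). -/
def NonExplosion (ν : Measure PointMeasure) : Prop :=
  ∀ ε : ℝ, 0 < ε → ε < 1 →
    ∫⁻ u in Set.Ioo (1 - ε) 1, (ENNReal.ofReal |genFun ν u - u|)⁻¹ = ∞

/-! ### The marked tree

A node `(u₁, …, uₙ)` of the Ulam–Harris tree is the list `[uₙ, …, u₁]`, so that the `i`-th child of
`u` is `i :: u`; labels start at `0`. In this part `y u i` is the relative size of the `i`-th child
of `u`, and `e u` is the exponential clock of `u`. -/

/-- Nodes of the tree. -/
abbrev Node : Type := List ℕ

/-- The size of a node, when the root has size `x`. -/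
def size (x : ℝ) (y : Node → ℕ → ℝ) : Node → ℝ
  | [] => x
  | i :: u => y u i * size x y u

/-- The lifetime of a node (irrelevant when the size is `0`). -/
def lifetime (α x : ℝ) (y : Node → ℕ → ℝ) (e : Node → ℝ) (u : Node) : ℝ :=
  size x y u ^ (-α) * e u

/-- The birth-time of a node. -/
def birth (α x : ℝ) (y : Node → ℕ → ℝ) (e : Node → ℝ) : Node → ℝ
  | [] => 0
  | _ :: u => birth α x y e u + lifetime α x y e u

/-- The node `u` is alive at time `t`: it has positive size, and `t ∈ [a_u, a_u + ζ_u)`. -/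
def Alive (α x : ℝ) (y : Node → ℕ → ℝ) (e : Node → ℝ) (t : ℝ) (u : Node) : Prop :=
  0 < size x y u ∧ birth α x y e u ≤ t ∧ t < birth α x y e u + lifetime α x y e u

open Classical in
/-- The sum of the Dirac masses at the sizes of the nodes that are alive at time `t`
(a measure which may a priori be infinite). -/
def population (α x : ℝ) (y : Node → ℕ → ℝ) (e : Node → ℝ) (t : ℝ) : Measure PosReal :=
  Measure.sum fun u : Node =>
    if h : Alive α x y e t u then Measure.dirac ⟨size x y u, h.1⟩ else 0

open Classical in
/-- The sum of the Dirac masses at the positive terms of a sequence. -/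
def sequenceMeasure (z : ℕ → ℝ) : Measure PosReal :=
  Measure.sum fun i : ℕ => if h : 0 < z i then Measure.dirac ⟨z i, h⟩ else 0

variable {Ω : Type*} [MeasurableSpace Ω]

/-- The random sequence `Z` of nonnegative reals has the law `ν`: almost surely there is an `n` such
that exactly the first `n` terms are nonzero, and the sum of the Dirac masses at these terms is
distributed according to `ν`. -/
def HasSequenceLaw (P : Measure Ω) (ν : Measure PointMeasure) (Z : ℕ → Ω → ℝ) : Prop :=
  (∀ᵐ ω ∂P, ∃ n : ℕ, ∀ i, 0 ≤ Z i ω ∧ (Z i ω = 0 ↔ n ≤ i)) ∧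
    P.map (fun ω => toPointMeasure (sequenceMeasure fun i => Z i ω)) = ν

/-- The random variables from which the marked tree is built: two independent families indexed by
the nodes, the family of the i.i.d. sequences `Y u = (Y u i)_i` of law `ν`, and the family of the
i.i.d. exponential variables `E u` of parameter `1`. -/
structure IsTreeNoise (P : Measure Ω) (ν : Measure PointMeasure)
    (Y : Node → ℕ → Ω → ℝ) (E : Node → Ω → ℝ) : Prop where
  measurable_offspring : ∀ u i, Measurable (Y u i)
  measurable_clock : ∀ u, Measurable (E u)
  offspring_law : ∀ u, HasSequenceLaw P ν (Y u)
  offspring_identDistrib : ∀ u v, IdentDistrib (fun ω i => Y u i ω) (fun ω i => Y v i ω) P P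
  offspring_indep : iIndepFun (fun u ω i => Y u i ω) P
  clock_law : ∀ u, P.map (E u) = expMeasure 1
  clock_indep : iIndepFun E P
  offspring_indep_clock : IndepFun (fun ω u i => Y u i ω) (fun ω u => E u ω) P

/-- The process `X` started from one individual of size `x`. The value `0` is used should the
population not be a finite point measure. -/
def X (α : ℝ) (Y : Node → ℕ → Ω → ℝ) (E : Node → Ω → ℝ) (x : PosReal) (t : ℝ≥0) (ω : Ω) :
    PointMeasure :=
  toPointMeasure (population α x (fun u i => Y u i ω) (fun u => E u ω) t)

/-- The σ-algebra generated by `X(r')`, `r' ≤ r`. -/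
@[reducible] def naturalSigma (α : ℝ) (Y : Node → ℕ → Ω → ℝ) (E : Node → Ω → ℝ) (x : PosReal) (r : ℝ≥0) :
    MeasurableSpace Ω :=
  ⨆ r' : Set.Iic r, MeasurableSpace.comap (X α Y E x r') inferInstance

end SelfSimilarBranching

end

open MeasureTheory ProbabilityTheory
open scoped ENNReal NNReal

noncomputable section

namespace SelfSimilarBranching

/-! ### Products of i.i.d. families -/

/-! Everything is proved on the canonical space of noises (i.i.d. marks on the nodes) and
transferred to `Ω` by `map_noise`.

Finiteness. For `α = 0` the birth times do not see the sizes. Let `q(t)` be the probability that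
only finitely many nodes of positive size are born by time `t`. Conditioning on the root gives `q' =
F(q) - q` with `q(0) = 1` (`finiteProb_eq`). If `q` ever left the value 1, it would decrease
strictly afterwards, and the substitution `u = q(s)` would bound the integral of `1 / |F(u) - u|`
near 1 by an elapsed time, against non-explosion (`eq_one_of_integral_eq`). For general `α`, the
Malthusian exponent `p` satisfies `∫ ⟨x ^ p, s⟩ ν(ds) = 1`, so a union bound over the children of
the root, iterated over generations, gives `P(some size > C) ≤ (x / C) ^ p` (`measure_exceeds_le`).
Hence the sizes are almost surely bounded by some `C`, lifetimes are at least `C ^ (-α)` times those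
for `α = 0`, and finitely many nodes are born by any time (`ae_finite_born`).

Markov and branching properties. The population at time `t + r` is the sum, over the nodes alive at
time `r`, of the populations at time `t` of their residual trees (`pop_add_apply`). By lack of
memory of the exponential law, the residual tree of a node alive at `r` is a fresh tree, independent
of everything outside the subtree of that node (`integral_alive_eq`). Being independent of the
inside of that subtree is expressed by invariance under `freeze`, and the path up to time `r` has
this invariance (`pathUntil_freeze`). Bounded multiplicative functions of point measures determine
laws (`ext_of_character`) and turn the sum into a product, whose factors are replaced by their means
one node at a time (`integral_mul_prod_charFactor`).

Scaling. It holds path by path: with one and the same noise, multiplying the initial size by `c`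
multiplies all sizes by `c` and all times by `c ^ (-α)` (`scale_treeX`). -/

lemma map_sumElim_prod_infinitePi {κ κ' β : Type*} [MeasurableSpace β] (m : Measure β)
    [IsProbabilityMeasure m] :
    ((Measure.infinitePi fun _ : κ => m).prod (Measure.infinitePi fun _ : κ' => m)).map
      (fun p i => Sum.elim p.1 p.2 i) = Measure.infinitePi fun _ : κ ⊕ κ' => m := by
  classical
  have hm : Measurable fun (p : (κ → β) × (κ' → β)) (i : κ ⊕ κ') => Sum.elim p.1 p.2 i := by
    refine measurable_pi_iff.2 fun i => ?_
    rcases i with i | i <;> simp <;> fun_prop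
  refine Measure.eq_infinitePi _ fun s t ht => ?_
  rw [Measure.map_apply hm (.pi s.countable_toSet fun i _ => ht i)]
  have : (fun (p : (κ → β) × (κ' → β)) (i : κ ⊕ κ') => Sum.elim p.1 p.2 i) ⁻¹' (Set.pi s t)
      = (Set.pi s.toLeft fun i => t (.inl i)) ×ˢ (Set.pi s.toRight fun i => t (.inr i)) := by
    ext p
    simp [Set.mem_pi]
  rw [this, Measure.prod_prod, Measure.infinitePi_pi _ (fun i _ => ht _),
    Measure.infinitePi_pi _ (fun i _ => ht _)]
  conv_rhs => rw [← Finset.toLeft_disjSum_toRight (u := s), Finset.prod_disjSum]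

/-- By injectivity no coordinate is read twice, so the selected family is again i.i.d. Both `graft`
and `join` are selections of this kind. -/
lemma map_select_prod_infinitePi {ι κ κ' β : Type*} [MeasurableSpace β] (m : Measure β)
    [IsProbabilityMeasure m] {f : ι → κ ⊕ κ'} (hf : Function.Injective f) :
    ((Measure.infinitePi fun _ : κ => m).prod (Measure.infinitePi fun _ : κ' => m)).map
      (fun p i => Sum.elim p.1 p.2 (f i)) = Measure.infinitePi fun _ : ι => m := by
  rw [← Measure.map_infinitePi_infinitePi_of_inj (P := fun _ : κ ⊕ κ' => m) hf,
    ← map_sumElim_prod_infinitePi, Measure.map_map (by fun_prop)]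
  · rfl
  · refine measurable_pi_iff.2 fun i => ?_
    rcases i with i | i <;> simp <;> fun_prop

/-- The mark of a node: the relative sizes of its children and its clock. -/
abbrev Mark : Type := (ℕ → ℝ) × ℝ

/-- A mark for each node. -/
abbrev Noise : Type := Node → Mark

/-- The law of a family of i.i.d. marks of law `m`. -/
def noiseLaw (m : Measure Mark) : Measure Noise := Measure.infinitePi fun _ => m

instance (m : Measure Mark) [IsProbabilityMeasure m] : IsProbabilityMeasure (noiseLaw m) := by
  unfold noiseLaw; infer_instance

/-- The marks `V` of the subtree with root `u`, the marks `W` elsewhere. -/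
def graft (u : Node) (W V : Noise) : Noise := fun w =>
  if u <:+ w then V (w.take (w.length - u.length)) else W w

@[simp] lemma graft_append (u : Node) (W V : Noise) (v : Node) :
    graft u W V (v ++ u) = V v := by
  simp [graft]

lemma graft_of_not_suffix {u w : Node} (W V : Noise) (h : ¬ u <:+ w) :
    graft u W V w = W w := by
  simp [graft, h]

lemma measurable_graft (u : Node) : Measurable fun p : Noise × Noise => graft u p.1 p.2 := by
  refine measurable_pi_iff.2 fun w => ?_
  by_cases h : u <:+ w <;> simp [graft, h] <;> fun_prop

/-- Resampling a subtree does not affect the law: each node reads its own coordinate, in the second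
family below `u` and in the first elsewhere. -/
lemma map_graft (m : Measure Mark) [IsProbabilityMeasure m] (u : Node) :
    ((noiseLaw m).prod (noiseLaw m)).map (fun p => graft u p.1 p.2) = noiseLaw m := by
  have hf : Function.Injective fun w : Node =>
      if u <:+ w then (Sum.inr (w.take (w.length - u.length)) : Node ⊕ Node) else .inl w := by
    intro w w' h
    by_cases hw : u <:+ w <;> by_cases hw' : u <:+ w'
    · obtain ⟨v, rfl⟩ := hw
      obtain ⟨v', rfl⟩ := hw'
      simpa using h
    all_goals simp_all
  refine Eq.trans ?_ (map_select_prod_infinitePi m hf)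
  unfold noiseLaw
  congr 1
  ext p : 1
  funext w
  by_cases h : u <:+ w <;> simp [graft, h]

/-- The tree with the mark `p.1` at the root and the marks `p.2 i` on the subtree of its `i`-th
child. -/
def join (p : Mark × (ℕ → Noise)) : Noise := fun w =>
  if h : w = [] then p.1 else p.2 (w.getLast h) w.dropLast

@[simp] lemma join_nil (p : Mark × (ℕ → Noise)) : join p [] = p.1 := by simp [join]

@[simp] lemma join_concat (p : Mark × (ℕ → Noise)) (v : Node) (i : ℕ) :
    join p (v ++ [i]) = p.2 i v := by simp [join]

lemma measurable_join : Measurable join := by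
  refine measurable_pi_iff.2 fun w => ?_
  by_cases h : w = [] <;> simp [join, h] <;> fun_prop

/-- Labels are prepended, so the last entry of a nonempty list is the child of the root from which
the node descends, and `dropLast` is its position below that child. This decomposition at the root
serves the equation for `finiteProb`, the bound on sizes and the lack of memory. -/
lemma map_join (m : Measure Mark) [IsProbabilityMeasure m] :
    (m.prod (Measure.infinitePi fun _ : ℕ => noiseLaw m)).map join = noiseLaw m := by
  have hf : Function.Injective fun w : Node =>
      if h : w = [] then (Sum.inl () : Unit ⊕ (ℕ × Node)) else .inr (w.getLast h, w.dropLast) := by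
    intro w w' h
    by_cases hw : w = [] <;> by_cases hw' : w' = []
    · simp_all
    · simp_all
    · simp_all
    · simp only [hw, hw', dite_false, Sum.inr.injEq, Prod.mk.injEq] at h
      rw [← List.dropLast_append_getLast hw, ← List.dropLast_append_getLast hw', h.1, h.2]
  -- The root mark is viewed as a family indexed by `Unit`, and the family of noises is uncurried,
  -- in order to apply the selection lemma.
  have h1 : m.map (fun a (_ : Unit) => a) = Measure.infinitePi fun _ : Unit => m := by
    refine Measure.eq_infinitePi _ fun s t ht => ?_
    rw [Measure.map_apply (by fun_prop) (.pi s.countable_toSet fun i _ => ht i)]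
    rcases Finset.eq_empty_or_nonempty s with rfl | hs
    · simp
    · have : s = {()} := by ext i; cases i; simpa using hs.choose_spec
      subst this
      simp only [Finset.coe_singleton, Set.singleton_pi, Finset.prod_singleton]
      rfl
  have h2 := Measure.infinitePi_map_curry_symm (ι := ℕ) (κ := Node) (X := Mark) fun _ _ => m
  refine Eq.trans ?_ (map_select_prod_infinitePi m hf)
  rw [← h1, ← h2, Measure.map_prod_map _ _ (by fun_prop) (by fun_prop), Measure.map_map]
  · congr 1
    ext p : 1
    funext w
    by_cases h : w = []
    · simp [join, h]
    · simp [join, h]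
  · refine measurable_pi_iff.2 fun i => ?_
    by_cases h : i = []
    · simp [h]
      fun_prop
    · simp [h]
      fun_prop
  · fun_prop

/-- Independent i.i.d. families of sequences and of clocks form an i.i.d. family of marks. -/
lemma iIndepFun_prodMk {Ω ι β γ : Type*} [MeasurableSpace Ω] [MeasurableSpace β]
    [MeasurableSpace γ] {P : Measure Ω} [IsProbabilityMeasure P] {f : ι → Ω → β} {g : ι → Ω → γ}
    (hf : ∀ i, Measurable (f i)) (hg : ∀ i, Measurable (g i)) (hfi : iIndepFun f P)
    (hgi : iIndepFun g P) (hfg : IndepFun (fun ω i => f i ω) (fun ω i => g i ω) P) :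
    iIndepFun (fun i ω => (f i ω, g i ω)) P := by
  classical
  -- It suffices to test independence on the π-systems of preimages of measurable rectangles.
  let π : ι → Set (Set Ω) := fun i =>
    Set.preimage (fun ω => (f i ω, g i ω)) '' (Set.image2 (· ×ˢ ·) {A | MeasurableSet A} {B | MeasurableSet B})
  have hle : ∀ i, MeasurableSpace.comap (fun ω => (f i ω, g i ω)) inferInstance ≤
      ‹MeasurableSpace Ω› := fun i => ((hf i).prodMk (hg i)).comap_le
  refine iIndepSets.iIndep (m := fun i => MeasurableSpace.comap (fun ω => (f i ω, g i ω))
    inferInstance) hle π (fun i => isPiSystem_prod.comap _) (fun i => ?_) ?_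
  · rw [← generateFrom_prod, MeasurableSpace.comap_generateFrom]
  rw [iIndepSets_iff]
  intro s F hF
  have : ∀ i, ∃ A B, MeasurableSet A ∧ MeasurableSet B ∧ (i ∈ s → F i = f i ⁻¹' A ∩ g i ⁻¹' B) := by
    intro i
    by_cases hi : i ∈ s
    · obtain ⟨_, ⟨A, hA, B, hB, rfl⟩, h⟩ := hF i hi
      exact ⟨A, B, hA, hB, fun _ => h.symm⟩
    · exact ⟨∅, ∅, .empty, .empty, fun h => absurd h hi⟩
  choose A B hA hB hAB using this
  have key : ∀ s' ⊆ s, P (⋂ i ∈ s', F i) = (∏ i ∈ s', P (f i ⁻¹' A i)) * ∏ i ∈ s', P (g i ⁻¹' B i) := by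
    intro s' hs'
    have h1 : ⋂ i ∈ s', F i = (⋂ i ∈ s', f i ⁻¹' A i) ∩ ⋂ i ∈ s', g i ⁻¹' B i := by
      rw [Set.iInter₂_congr fun i hi => hAB i (hs' hi)]
      simp only [Set.iInter_inter_distrib]
    have h2 := hfg.measure_inter_preimage_eq_mul (Set.pi s' A) (Set.pi s' B)
      (.pi s'.countable_toSet fun i _ => hA i) (.pi s'.countable_toSet fun i _ => hB i)
    have h3 : (fun ω i => f i ω) ⁻¹' (Set.pi s' A) = ⋂ i ∈ s', f i ⁻¹' A i := by
      ext; simp [Set.mem_pi]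
    have h4 : (fun ω i => g i ω) ⁻¹' (Set.pi s' B) = ⋂ i ∈ s', g i ⁻¹' B i := by
      ext; simp [Set.mem_pi]
    rw [h1, ← h3, ← h4, h2, h3, h4, hfi.measure_inter_preimage_eq_mul s' (fun i _ => hA i),
      hgi.measure_inter_preimage_eq_mul s' (fun i _ => hB i)]
  rw [key s subset_rfl, ← Finset.prod_mul_distrib]
  refine Finset.prod_congr rfl fun i hi => ?_
  -- The factor of index `i` is identified by the same product formula for a single index.
  have := key {i} (by simpa using hi)
  simpa using this.symm

/-! ### Sizes and birth times along the tree -/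

lemma size_append (x : ℝ) (y : Node → ℕ → ℝ) (v u : Node) :
    size x y (v ++ u) = size (size x y u) (fun w => y (w ++ u)) v := by
  induction v with
  | nil => rfl
  | cons i v ih => simp only [List.cons_append, size, ih]

lemma birth_append (α x : ℝ) (y : Node → ℕ → ℝ) (e : Node → ℝ) (v u : Node) :
    birth α x y e (v ++ u) = birth α x y e u +
      birth α (size x y u) (fun w => y (w ++ u)) (fun w => e (w ++ u)) v := by
  induction v with
  | nil => simp [birth]
  | cons i v ih => simp only [List.cons_append, birth, lifetime, ih, size_append]; ring

lemma size_congr {x : ℝ} {y y' : Node → ℕ → ℝ} {u : Node}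
    (h : ∀ w, w <:+ u → w ≠ u → y w = y' w) : size x y u = size x y' u := by
  induction u with
  | nil => rfl
  | cons i u ih =>
    simp only [size]
    rw [h u (List.suffix_cons i u) (by simp), ih fun w hw hne =>
      h w (hw.trans (List.suffix_cons i u)) fun h' => by
        have := hw.length_le
        simp [h'] at this]

lemma birth_congr {α x : ℝ} {y y' : Node → ℕ → ℝ} {e e' : Node → ℝ} {u : Node}
    (h : ∀ w, w <:+ u → w ≠ u → y w = y' w) (h' : ∀ w, w <:+ u → w ≠ u → e w = e' w) :
    birth α x y e u = birth α x y' e' u := by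
  induction u with
  | nil => rfl
  | cons i u ih =>
    have aux : ∀ w, w <:+ u → w <:+ (i :: u) ∧ w ≠ i :: u := fun w hw =>
      ⟨hw.trans (List.suffix_cons i u), fun h' => by
        have := hw.length_le
        simp [h'] at this⟩
    simp only [birth, lifetime]
    rw [h' u (List.suffix_cons i u) (by simp), ih (fun w hw _ => h w (aux w hw).1 (aux w hw).2)
      (fun w hw _ => h' w (aux w hw).1 (aux w hw).2),
      size_congr (fun w hw _ => h w (aux w hw).1 (aux w hw).2)]

lemma size_nonneg {x : ℝ} {y : Node → ℕ → ℝ} (hx : 0 ≤ x) (hy : ∀ u i, 0 ≤ y u i) (u : Node) :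
    0 ≤ size x y u := by
  induction u with
  | nil => exact hx
  | cons i u ih => exact mul_nonneg (hy u i) ih

lemma size_zero_left (y : Node → ℕ → ℝ) (u : Node) : size 0 y u = 0 := by
  induction u with
  | nil => rfl
  | cons i u ih => simp [size, ih]

lemma size_pos_of_append {x : ℝ} {y : Node → ℕ → ℝ} (hx : 0 ≤ x) (hy : ∀ u i, 0 ≤ y u i)
    {v u : Node} (h : 0 < size x y (v ++ u)) : 0 < size x y u := by
  refine lt_of_le_of_ne (size_nonneg hx hy u) fun h0 => ?_
  rw [size_append, ← h0, size_zero_left] at h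
  exact lt_irrefl _ h

lemma lifetime_nonneg {α x : ℝ} {y : Node → ℕ → ℝ} {e : Node → ℝ} (hx : 0 ≤ x)
    (hy : ∀ u i, 0 ≤ y u i) (he : ∀ u, 0 ≤ e u) (u : Node) : 0 ≤ lifetime α x y e u :=
  mul_nonneg (Real.rpow_nonneg (size_nonneg hx hy u) _) (he u)

lemma birth_nonneg {α x : ℝ} {y : Node → ℕ → ℝ} {e : Node → ℝ} (hx : 0 ≤ x)
    (hy : ∀ u i, 0 ≤ y u i) (he : ∀ u, 0 ≤ e u) (u : Node) : 0 ≤ birth α x y e u := by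
  induction u with
  | nil => exact le_rfl
  | cons i u ih => exact add_nonneg ih (lifetime_nonneg hx hy he u)

lemma death_le_birth_append {α x : ℝ} {y : Node → ℕ → ℝ} {e : Node → ℝ} (hx : 0 ≤ x)
    (hy : ∀ u i, 0 ≤ y u i) (he : ∀ u, 0 ≤ e u) {v : Node} (hv : v ≠ []) (u : Node) :
    birth α x y e u + lifetime α x y e u ≤ birth α x y e (v ++ u) := by
  induction v with
  | nil => exact absurd rfl hv
  | cons i v ih =>
    rcases eq_or_ne v [] with rfl | h
    · exact le_rfl
    · exact (ih h).trans (le_add_of_nonneg_right (lifetime_nonneg hx hy he _))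

/-! ### The noise -/

/-- The relative sizes of the children. -/
abbrev ratios (W : Noise) : Node → ℕ → ℝ := fun u i => (W u).1 i

/-- The clocks of the nodes. -/
abbrev clocks (W : Noise) : Node → ℝ := fun u => (W u).2

/-- Noises with nonnegative ratios and clocks, and with finitely many children at each node. -/
structure IsGood (W : Noise) : Prop where
  ratios_nonneg : ∀ u i, 0 ≤ ratios W u i
  clocks_nonneg : ∀ u, 0 ≤ clocks W u
  children : ∀ u, ∃ n : ℕ, ∀ i, ratios W u i = 0 ↔ n ≤ i

/-- The noise on the subtree with root `u`. -/
def subtree (u : Node) (W : Noise) : Noise := fun v => W (v ++ u)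

/-- The noise with the clock of the root diminished by `θ`. -/
def shiftClock (θ : ℝ) (V : Noise) : Noise := Function.update V [] ((V []).1, (V []).2 - θ)

/-- The value which the clock of `u` has to exceed if `u` is alive at time `r`. -/
def threshold (α x r : ℝ) (W : Noise) (u : Node) : ℝ :=
  (r - birth α x (ratios W) (clocks W) u) * size x (ratios W) u ^ α

/-- The noise on the subtree with root `u`, seen from time `r`. -/
def residual (α x r : ℝ) (W : Noise) (u : Node) : Noise :=
  shiftClock (threshold α x r W u) (subtree u W)

lemma ratios_shiftClock (θ : ℝ) (V : Noise) : ratios (shiftClock θ V) = ratios V := by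
  funext w i
  by_cases h : w = []
  · subst h; simp [ratios, shiftClock]
  · simp [ratios, shiftClock, h]

lemma clocks_shiftClock_nil (θ : ℝ) (V : Noise) :
    clocks (shiftClock θ V) [] = clocks V [] - θ := by
  simp [clocks, shiftClock]

lemma clocks_shiftClock {v : Node} (hv : v ≠ []) (θ : ℝ) (V : Noise) :
    clocks (shiftClock θ V) v = clocks V v := by
  simp [clocks, shiftClock, hv]

/-- The clock of the root enters the birth time of each of its strict descendants exactly once. -/
lemma birth_shiftClock {v : Node} (hv : v ≠ []) (α x θ : ℝ) (V : Noise) :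
    birth α x (ratios (shiftClock θ V)) (clocks (shiftClock θ V)) v =
      birth α x (ratios V) (clocks V) v - x ^ (-α) * θ := by
  rw [ratios_shiftClock]
  induction v with
  | nil => exact absurd rfl hv
  | cons i v ih =>
    simp only [birth, lifetime]
    rcases eq_or_ne v [] with rfl | h
    · simp only [birth, size, clocks_shiftClock_nil]; ring
    · rw [ih h, clocks_shiftClock h]; ring

/-- The size, the birth time and the threshold depend only on the marks of strict ancestors. The
clock of `u` is thus isolated on one side of one inequality, as lack of memory requires. -/
lemma alive_iff {α x r : ℝ} {W : Noise} {u : Node} :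
    Alive α x (ratios W) (clocks W) r u ↔ (0 < size x (ratios W) u ∧
      birth α x (ratios W) (clocks W) u ≤ r) ∧ threshold α x r W u < clocks W u := by
  rw [Alive, and_assoc]
  refine and_congr_right fun hs => and_congr_right fun _ => ?_
  rw [threshold, lifetime, Real.rpow_neg hs.le, ← sub_lt_iff_lt_add', ← div_eq_inv_mul,
    lt_div_iff₀ (Real.rpow_pos_of_pos hs _)]

lemma threshold_nonneg {α x r : ℝ} {W : Noise} {u : Node} (hs : 0 < size x (ratios W) u)
    (hb : birth α x (ratios W) (clocks W) u ≤ r) : 0 ≤ threshold α x r W u :=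
  mul_nonneg (sub_nonneg.2 hb) (Real.rpow_nonneg hs.le _)

/-- Removing the threshold from the clock of `u` removes from its lifetime exactly its age `r - a_u`
at time `r`; the origin of time is thereby moved to `r`, for `u` and for all its descendants. -/
lemma alive_residual {α x r t : ℝ} {W : Noise} {u : Node}
    (hu : Alive α x (ratios W) (clocks W) r u) (ht : 0 ≤ t) (v : Node) :
    Alive α (size x (ratios W) u) (ratios (residual α x r W u)) (clocks (residual α x r W u)) t v ↔
      Alive α x (ratios W) (clocks W) (t + r) (v ++ u) := by
  have hs := hu.1
  have hθ : size x (ratios W) u ^ (-α) * threshold α x r W u =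
      r - birth α x (ratios W) (clocks W) u := by
    rw [threshold, mul_left_comm, ← Real.rpow_add hs]
    simp
  have hb := birth_append α x (ratios W) (clocks W) v u
  have hsz := size_append x (ratios W) v u
  change _ = size (size x (ratios W) u) (ratios (subtree u W)) v at hsz
  change _ = _ + birth α (size x (ratios W) u) (ratios (subtree u W)) (clocks (subtree u W)) v at hb
  unfold Alive lifetime
  rw [hsz]
  rcases eq_or_ne v [] with rfl | h
  · rw [residual, ratios_shiftClock, clocks_shiftClock_nil]
    simp only [size, birth, List.nil_append, mul_sub, hθ]
    have : clocks (subtree u W) [] = clocks W u := rfl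
    rw [this]
    have := hu.2.1
    constructor
    · rintro ⟨h1, h2, h3⟩
      exact ⟨h1, by linarith, by linarith⟩
    · rintro ⟨h1, h2, h3⟩
      exact ⟨h1, by linarith, by linarith⟩
  · rw [residual, birth_shiftClock h, ratios_shiftClock, clocks_shiftClock h, hθ, hb]
    have : clocks (subtree u W) v = clocks W (v ++ u) := rfl
    rw [this]
    constructor
    · rintro ⟨h1, h2, h3⟩
      exact ⟨h1, by linarith, by linarith⟩
    · rintro ⟨h1, h2, h3⟩
      exact ⟨h1, by linarith, by linarith⟩

/-- Strict descendants of `u` are not born before its death, which comes after `r`. Allowing `r' ≤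
r` is what makes freezing harmless to the whole past of `r`. -/
lemma alive_antichain {α x r r' : ℝ} {W : Noise} (hW : IsGood W) (hx : 0 ≤ x) {u v : Node}
    (hu : Alive α x (ratios W) (clocks W) r u) (hr : r' ≤ r)
    (hv : Alive α x (ratios W) (clocks W) r' v) (huv : u <:+ v) : u = v := by
  obtain ⟨z, rfl⟩ := huv
  rcases eq_or_ne z [] with rfl | h
  · rfl
  · have := death_le_birth_append (α := α) hx hW.ratios_nonneg hW.clocks_nonneg h u
    exact absurd (hu.2.2.trans_le (this.trans hv.2.1)) (not_lt.2 hr)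

lemma exists_ancestor_alive {α x r t : ℝ} {W : Noise} (hW : IsGood W) (hx : 0 ≤ x) (hr : 0 ≤ r)
    (ht : 0 ≤ t) {w : Node} (hw : Alive α x (ratios W) (clocks W) (t + r) w) :
    ∃ u, u <:+ w ∧ Alive α x (ratios W) (clocks W) r u := by
  -- Climb from a node born after `r` towards the root, born at time 0. The first ancestor born by
  -- time `r` is alive then, since its death is the birth of a node born after `r`.
  have key : ∀ v : Node, v <:+ w → r < birth α x (ratios W) (clocks W) v →
      ∃ u, u <:+ w ∧ Alive α x (ratios W) (clocks W) r u := by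
    intro v
    induction v with
    | nil => intro _ h; exact absurd h (not_lt.2 hr)
    | cons i v ih =>
      intro hs h
      have hvw : v <:+ w := (List.suffix_cons i v).trans hs
      rcases lt_or_ge r (birth α x (ratios W) (clocks W) v) with h' | h'
      · exact ih hvw h'
      · refine ⟨v, hvw, ?_, h', h⟩
        obtain ⟨z, rfl⟩ := hvw
        exact size_pos_of_append hx hW.ratios_nonneg hw.1
  rcases lt_or_ge r (birth α x (ratios W) (clocks W) w) with h | h
  · exact key w List.suffix_rfl h
  · exact ⟨w, List.suffix_rfl, hw.1, h, by linarith [hw.2.2]⟩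

/-! ### The population -/

open Classical in
/-- A positive real number as an element of `PosReal` (and `1` for the other real numbers). -/
def toPos (x : ℝ) : PosReal := if h : 0 < x then ⟨x, h⟩ else ⟨1, one_pos⟩

lemma toPos_of_pos {x : ℝ} (h : 0 < x) : toPos x = ⟨x, h⟩ := dif_pos h

/-- The population as a function of the noise. -/
abbrev pop (α x t : ℝ) (W : Noise) : Measure PosReal := population α x (ratios W) (clocks W) t

open Classical in
lemma pop_apply (α x t : ℝ) (W : Noise) {B : Set PosReal} (hB : MeasurableSet B) :
    pop α x t W B = ∑' u, if Alive α x (ratios W) (clocks W) t u then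
      Measure.dirac (toPos (size x (ratios W) u)) B else 0 := by
  rw [pop, population, Measure.sum_apply _ hB]
  refine tsum_congr fun u => ?_
  split_ifs with h
  · rw [toPos_of_pos h.1]
  · rfl

open Classical in
-- The nodes alive at `t + r` are sorted by their ancestor alive at `r`, which exists and is unique.
-- All sums are in `[0, ∞]`, so no finiteness is needed yet.
lemma pop_add_apply {α x r t : ℝ} {W : Noise} (hW : IsGood W) (hx : 0 ≤ x) (hr : 0 ≤ r)
    (ht : 0 ≤ t) {B : Set PosReal} (hB : MeasurableSet B) :
    pop α x (t + r) W B = ∑' u, if Alive α x (ratios W) (clocks W) r u then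
      pop α (size x (ratios W) u) t (residual α x r W u) B else 0 := by
  set f : Node → ℝ≥0∞ := fun w => if Alive α x (ratios W) (clocks W) (t + r) w then
      Measure.dirac (toPos (size x (ratios W) w)) B else 0 with hf
  have h1 : ∀ w, f w = ∑' u, if Alive α x (ratios W) (clocks W) r u ∧ u <:+ w then f w else 0 := by
    intro w
    by_cases hw : Alive α x (ratios W) (clocks W) (t + r) w
    · obtain ⟨u, huw, hu⟩ := exists_ancestor_alive hW hx hr ht hw
      rw [tsum_eq_single u, if_pos ⟨hu, huw⟩]
      intro u' hne
      rw [if_neg]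
      rintro ⟨hu', huw'⟩
      rcases List.suffix_or_suffix_of_suffix huw huw' with h | h
      · exact hne (alive_antichain hW hx hu le_rfl hu' h).symm
      · exact hne (alive_antichain hW hx hu' le_rfl hu h)
    · have : f w = 0 := if_neg hw
      simp [this]
  rw [pop_apply _ _ _ _ hB, tsum_congr h1, ENNReal.tsum_comm]
  refine tsum_congr fun u => ?_
  by_cases hu : Alive α x (ratios W) (clocks W) r u
  · simp only [hu, true_and, if_true]
    rw [pop_apply _ _ _ _ hB]
    have hinj : Function.Injective fun v : Node => v ++ u := fun v v' h => by simpa using h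
    -- The descendants of `u` are parametrized injectively by `v ↦ v ++ u`.
    rw [← hinj.tsum_eq (f := fun w => if u <:+ w then f w else 0)]
    · refine tsum_congr fun v => ?_
      have : u <:+ v ++ u := List.suffix_append v u
      rw [if_pos this]
      simp only [hf, alive_residual hu ht, size_append]
      rw [residual, ratios_shiftClock]
      rfl
    · intro w hw
      by_cases h : u <:+ w
      · obtain ⟨v, rfl⟩ := h
        exact ⟨v, rfl⟩
      · simp [h] at hw
  · simp [hu]

/-! ### Freezing a node -/

/-- The noise with the subtree of `u` replaced by a node that has no child and is alive at time `r`
if it is born before `r`. -/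
def freeze (α x r : ℝ) (u : Node) (W : Noise) : Noise :=
  graft u W fun _ => (0, threshold α x r W u + 1)

/-- The hypothesis `huv` says that `v` is not a strict descendant of `u`. Then no strict ancestor of
`v` lies in the subtree of `u`, even when `v = u`. -/
lemma graft_of_proper_suffix {u w v : Node} (hw : w <:+ v) (hne : w ≠ v) (huv : u <:+ v → u = v)
    (W V : Noise) : graft u W V w = W w := by
  refine graft_of_not_suffix W V fun h => hne ?_
  have := huv (h.trans hw)
  subst this
  exact hw.eq_of_length (le_antisymm hw.length_le h.length_le)

lemma size_graft {u v : Node} (huv : u <:+ v → u = v) (x : ℝ) (W V : Noise) :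
    size x (ratios (graft u W V)) v = size x (ratios W) v :=
  size_congr fun w hw hne => by
    funext i; simp only [ratios, graft_of_proper_suffix hw hne huv]

lemma birth_graft {u v : Node} (huv : u <:+ v → u = v) (α x : ℝ) (W V : Noise) :
    birth α x (ratios (graft u W V)) (clocks (graft u W V)) v =
      birth α x (ratios W) (clocks W) v :=
  birth_congr (fun w hw hne => by
    funext i; simp only [ratios, graft_of_proper_suffix hw hne huv])
    (fun w hw hne => by simp only [clocks, graft_of_proper_suffix hw hne huv])

lemma threshold_graft {u v : Node} (huv : u <:+ v → u = v) (α x r : ℝ) (W V : Noise) :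
    threshold α x r (graft u W V) v = threshold α x r W v := by
  rw [threshold, size_graft huv, birth_graft huv, threshold]

lemma graft_graft (u : Node) (W V V' : Noise) : graft u (graft u W V) V' = graft u W V' := by
  funext w
  by_cases h : u <:+ w <;> simp [graft, h]

/-- The threshold of `u` is fixed by its strict ancestors, so the frozen noise forgets whatever was
grafted at `u`. -/
lemma freeze_graft (α x r : ℝ) (u : Node) (W V : Noise) :
    freeze α x r u (graft u W V) = freeze α x r u W := by
  rw [freeze, graft_graft, threshold_graft (fun _ => rfl), freeze]

lemma residual_graft (α x r : ℝ) (u : Node) (W V : Noise) :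
    residual α x r (graft u W V) u = shiftClock (threshold α x r W u) V := by
  rw [residual, threshold_graft (fun _ => rfl)]
  congr 1
  funext v
  simp [subtree]

lemma alive_freeze {α x r r' : ℝ} {W : Noise} (hW : IsGood W) (hx : 0 ≤ x) {u : Node}
    (hu : Alive α x (ratios W) (clocks W) r u) (hr : r' ≤ r) (v : Node) :
    Alive α x (ratios (freeze α x r u W)) (clocks (freeze α x r u W)) r' v ↔
      Alive α x (ratios W) (clocks W) r' v := by
  by_cases huv : u <:+ v → u = v
  · by_cases h : u = v
    · subst h
      have hc : clocks (freeze α x r u W) u = threshold α x r W u + 1 := by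
        have := graft_append u W (fun _ => (0, threshold α x r W u + 1)) []
        simp only [List.nil_append] at this
        simp only [freeze, clocks, this]
      have hA : Alive α x (ratios (freeze α x r u W)) (clocks (freeze α x r u W)) r u := by
        rw [alive_iff]
        refine ⟨?_, ?_⟩
        · rw [freeze, size_graft huv, birth_graft huv]; exact (alive_iff.1 hu).1
        · rw [hc, freeze, threshold_graft huv]; linarith
      have hb : birth α x (ratios (freeze α x r u W)) (clocks (freeze α x r u W)) u =
          birth α x (ratios W) (clocks W) u := birth_graft huv _ _ _ _
      constructor
      · intro h'
        exact ⟨hu.1, hb ▸ h'.2.1, hr.trans_lt hu.2.2⟩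
      · intro h'
        exact ⟨hA.1, hb ▸ h'.2.1, hr.trans_lt hA.2.2⟩
    · have hc : clocks (freeze α x r u W) v = clocks W v := by
        simp only [freeze, clocks, graft_of_not_suffix _ _ fun h' => h (huv h')]
      rw [Alive, Alive, lifetime, lifetime, hc, freeze, size_graft huv, birth_graft huv]
  -- A strict descendant of `u` has size 0 in the frozen noise, and is not yet born at time `r'` in
  -- the original one.
  · push Not at huv
    obtain ⟨⟨z, rfl⟩, hne⟩ := huv
    have hz : z ≠ [] := by rintro rfl; exact hne rfl
    constructor
    · intro h
      have h0 := h.1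
      obtain ⟨i, z, rfl⟩ := List.exists_cons_of_ne_nil hz
      simp [size, freeze, ratios] at h0
    · intro h
      exact absurd (alive_antichain hW hx hu hr h (List.suffix_append z u)) hne

lemma size_freeze_of_alive {α x r r' : ℝ} {W : Noise} (hW : IsGood W) (hx : 0 ≤ x) {u : Node}
    (hu : Alive α x (ratios W) (clocks W) r u) (hr : r' ≤ r) {v : Node}
    (hv : Alive α x (ratios W) (clocks W) r' v) :
    size x (ratios (freeze α x r u W)) v = size x (ratios W) v :=
  size_graft (fun h => alive_antichain hW hx hu hr hv h) _ _ _

lemma pop_freeze {α x r r' : ℝ} {W : Noise} (hW : IsGood W) (hx : 0 ≤ x) {u : Node}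
    (hu : Alive α x (ratios W) (clocks W) r u) (hr : r' ≤ r) :
    pop α x r' (freeze α x r u W) = pop α x r' W := by
  classical
  ext B hB
  rw [pop_apply _ _ _ _ hB, pop_apply _ _ _ _ hB]
  refine tsum_congr fun v => ?_
  by_cases hv : Alive α x (ratios W) (clocks W) r' v
  · rw [if_pos hv, if_pos ((alive_freeze hW hx hu hr v).2 hv), size_freeze_of_alive hW hx hu hr hv]
  · rw [if_neg hv, if_neg (fun h => hv ((alive_freeze hW hx hu hr v).1 h))]

/-- Distinct nodes alive at the same time are incomparable, so their subtrees are disjoint. -/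
lemma residual_freeze {α x r : ℝ} {W : Noise} (hW : IsGood W) (hx : 0 ≤ x) {u v : Node}
    (hu : Alive α x (ratios W) (clocks W) r u) (hv : Alive α x (ratios W) (clocks W) r v)
    (hne : u ≠ v) : residual α x r (freeze α x r u W) v = residual α x r W v := by
  have h1 : ¬ u <:+ v := fun h => hne (alive_antichain hW hx hu le_rfl hv h)
  have h2 : ¬ v <:+ u := fun h => hne (alive_antichain hW hx hv le_rfl hu h).symm
  rw [residual, residual, freeze, threshold_graft (fun h => absurd h h1)]
  congr 1
  funext z
  refine graft_of_not_suffix _ _ fun h => ?_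
  rcases List.suffix_or_suffix_of_suffix h (List.suffix_append z v) with h | h
  · exact h1 h
  · exact h2 h

section

/-! ### Point measures -/

open Classical in
lemma coe_toPointMeasure (μ : Measure PosReal) :
    (toPointMeasure μ : Measure PosReal) = if μ ∈ pointMeasures then μ else 0 := by
  unfold toPointMeasure
  split_ifs <;> rfl

lemma toPointMeasure_of_mem {μ : Measure PosReal} (h : μ ∈ pointMeasures) :
    (toPointMeasure μ : Measure PosReal) = μ := by
  rw [coe_toPointMeasure, if_pos h]

lemma univ_lt_top (s : PointMeasure) : (s : Measure PosReal) Set.univ < ∞ := by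
  obtain ⟨μ, l, rfl⟩ := s
  induction l using Multiset.induction_on with
  | empty => simp
  | cons a l ih => simpa using ih

instance (s : PointMeasure) : IsFiniteMeasure (s : Measure PosReal) := ⟨univ_lt_top s⟩

lemma measurable_coe_apply {B : Set PosReal} (hB : MeasurableSet B) :
    Measurable fun s : PointMeasure => (s : Measure PosReal) B :=
  (Measure.measurable_coe hB).comp measurable_subtype_coe

lemma measurable_pointMeasure {β : Type*} [MeasurableSpace β] {f : β → PointMeasure}
    (h : ∀ B : Set PosReal, MeasurableSet B → Measurable fun a => (f a : Measure PosReal) B) :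
    Measurable f :=
  (Measure.measurable_of_measurable_coe _ h).subtype_mk

lemma measurable_toPointMeasure {β : Type*} [MeasurableSpace β] {f : β → Measure PosReal}
    (hf : Measurable f) (h : MeasurableSet {a | f a ∈ pointMeasures}) :
    Measurable fun a => toPointMeasure (f a) := by
  classical
  refine measurable_pointMeasure fun B hB => ?_
  have : (fun a => (toPointMeasure (f a) : Measure PosReal) B) =
      fun a => if f a ∈ pointMeasures then f a B else 0 := by
    funext a
    rw [coe_toPointMeasure]
    split_ifs <;> simp
  rw [this]
  exact Measurable.ite h ((Measure.measurable_coe hB).comp hf) measurable_const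

@[simp] lemma coe_atom (x : PosReal) : (atom x : Measure PosReal) = Measure.dirac x := rfl

lemma exists_eq_sum_atom (s : PointMeasure) : ∃ l : List PosReal, s = (l.map atom).sum := by
  obtain ⟨μ, m, rfl⟩ := s
  suffices h : ∃ l : List PosReal, (m.map Measure.dirac).sum =
      ((l.map atom).sum : PointMeasure) by
    obtain ⟨l, h⟩ := h
    exact ⟨l, Subtype.ext h⟩
  induction m using Multiset.induction_on with
  | empty => exact ⟨[], rfl⟩
  | cons a m ih =>
    obtain ⟨l, h⟩ := ih
    exact ⟨a :: l, by simp only [Multiset.map_cons, Multiset.sum_cons, h]; rfl⟩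

/-! ### Sums of Dirac masses over a selected set of indices -/

section DiracSum

variable {ι : Type*} (p : ι → Prop) (z : ι → PosReal)

open Classical in
/-- The sum of the Dirac masses at the points `z i` for which `p i` holds. -/
def diracSum : Measure PosReal := Measure.sum fun i => if p i then Measure.dirac (z i) else 0

open Classical in
lemma diracSum_apply {B : Set PosReal} (hB : MeasurableSet B) :
    diracSum p z B = ∑' i, if p i then Measure.dirac (z i) B else 0 := by
  rw [diracSum, Measure.sum_apply _ hB]
  refine tsum_congr fun i => ?_
  split_ifs <;> rfl

lemma diracSum_of_finite (h : {i | p i}.Finite) :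
    diracSum p z = ((∑ i ∈ h.toFinset, atom (z i) : PointMeasure) : Measure PosReal) := by
  classical
  ext B hB
  rw [diracSum_apply p z hB, tsum_eq_sum (s := h.toFinset)]
  · simp only [AddSubmonoid.coe_finsetSum, coe_atom, Measure.finsetSum_apply]
    exact Finset.sum_congr rfl fun i hi => if_pos (by simpa using hi)
  · intro i hi
    exact if_neg (by simpa using hi)

lemma finite_of_diracSum_univ_lt_top (h : diracSum p z Set.univ < ∞) : {i | p i}.Finite := by
  classical
  rw [diracSum_apply p z .univ] at h
  have := ENNReal.finite_const_le_of_tsum_ne_top h.ne (one_ne_zero (α := ℝ≥0∞))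
  refine this.subset fun i hi => ?_
  simp only [Set.mem_ofPred_eq] at hi
  simp [hi]

/-- Each selected index contributes mass 1, so finite mass means finitely many indices. This turns
membership in `pointMeasures` into a measurable condition. -/
lemma diracSum_mem_iff : diracSum p z ∈ pointMeasures ↔ diracSum p z Set.univ < ∞ :=
  ⟨fun h => univ_lt_top ⟨_, h⟩, fun h => by
    rw [diracSum_of_finite p z (finite_of_diracSum_univ_lt_top p z h)]; exact Subtype.coe_prop _⟩

lemma toPointMeasure_diracSum (h : {i | p i}.Finite) :
    toPointMeasure (diracSum p z) = ∑ i ∈ h.toFinset, atom (z i) := by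
  refine Subtype.ext ?_
  rw [diracSum_of_finite p z h, toPointMeasure_of_mem (Subtype.coe_prop _)]

lemma measurable_diracSum {β : Type*} [MeasurableSpace β] [Countable ι] {p : β → ι → Prop}
    {z : β → ι → PosReal} (hp : ∀ i, MeasurableSet {a | p a i}) (hz : ∀ i, Measurable fun a => z a i) :
    Measurable fun a => diracSum (p a) (z a) := by
  classical
  refine Measure.measurable_of_measurable_coe _ fun B hB => ?_
  simp_rw [fun a => diracSum_apply (p a) (z a) hB]
  refine Measurable.tsum fun i => Measurable.ite (hp i) ?_ measurable_const
  exact ((Measure.measurable_coe hB).comp Measure.measurable_dirac).comp (hz i)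

lemma measurable_toPointMeasure_diracSum {β : Type*} [MeasurableSpace β] [Countable ι]
    {p : β → ι → Prop} {z : β → ι → PosReal} (hp : ∀ i, MeasurableSet {a | p a i})
    (hz : ∀ i, Measurable fun a => z a i) :
    Measurable fun a => toPointMeasure (diracSum (p a) (z a)) := by
  have h := measurable_diracSum hp hz
  refine measurable_toPointMeasure h ?_
  simp_rw [diracSum_mem_iff]
  exact measurableSet_lt ((Measure.measurable_coe .univ).comp h) measurable_const

end DiracSum

lemma measurable_toPos : Measurable toPos := by
  classical
  have : Measurable fun x : ℝ => if 0 < x then x else 1 :=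
    Measurable.ite measurableSet_Ioi measurable_id measurable_const
  have h : toPos = fun x => ⟨if 0 < x then x else 1, by split_ifs with h; exacts [h, one_pos]⟩ := by
    funext x
    unfold toPos
    split_ifs <;> simp_all
  rw [h]
  exact this.subtype_mk

/-! ### The process as a function of the noise -/

lemma pop_eq_diracSum (α x t : ℝ) (W : Noise) : pop α x t W =
    diracSum (Alive α x (ratios W) (clocks W) t) fun u => toPos (size x (ratios W) u) := by
  classical
  ext B hB
  rw [pop_apply _ _ _ _ hB, diracSum_apply _ _ hB]

lemma measurable_size (u : Node) : Measurable fun p : ℝ × Noise => size p.1 (ratios p.2) u := by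
  induction u with
  | nil => exact measurable_fst
  | cons i u ih =>
    simp only [size]
    refine Measurable.mul ?_ ih
    simp only [ratios]
    fun_prop

lemma measurable_lifetime (α : ℝ) (u : Node) :
    Measurable fun p : ℝ × Noise => lifetime α p.1 (ratios p.2) (clocks p.2) u := by
  refine ((measurable_size u).pow_const _).mul ?_
  simp only [clocks]
  fun_prop

lemma measurable_birth (α : ℝ) (u : Node) :
    Measurable fun p : ℝ × Noise => birth α p.1 (ratios p.2) (clocks p.2) u := by
  induction u with
  | nil => exact measurable_const
  | cons i u ih => exact ih.add (measurable_lifetime α u)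

lemma measurableSet_alive (α t : ℝ) (u : Node) :
    MeasurableSet {p : ℝ × Noise | Alive α p.1 (ratios p.2) (clocks p.2) t u} :=
  (measurableSet_lt measurable_const (measurable_size u)).inter
    ((measurableSet_le (measurable_birth α u) measurable_const).inter
      (measurableSet_lt measurable_const ((measurable_birth α u).add (measurable_lifetime α u))))

/-- The process as a function of the noise. -/
def treeX (α t x : ℝ) (W : Noise) : PointMeasure := toPointMeasure (pop α x t W)

lemma measurable_treeX (α t : ℝ) : Measurable fun p : ℝ × Noise => treeX α t p.1 p.2 := by
  have h : (fun p : ℝ × Noise => treeX α t p.1 p.2) = fun p => toPointMeasure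
      (diracSum (Alive α p.1 (ratios p.2) (clocks p.2) t) fun u => toPos (size p.1 (ratios p.2) u)) :=
    funext fun p => congrArg toPointMeasure (pop_eq_diracSum α p.1 t p.2)
  rw [h]
  exact measurable_toPointMeasure_diracSum (fun u => measurableSet_alive α t u)
    fun u => measurable_toPos.comp (measurable_size u)

lemma measurable_treeX_right (α t x : ℝ) : Measurable fun W => treeX α t x W :=
  Measurable.comp (f := fun W : Noise => ((x, W) : ℝ × Noise)) (measurable_treeX α t)
    (measurable_const.prodMk measurable_id)

end

section

/-! ### The differential equation for the probability of no explosion -/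

section ODE

variable {F q : ℝ → ℝ}

/-- Only monotonicity of `q` is known at first; it makes the integrand locally integrable, and the
integral equation then improves the regularity of `q`, to continuity here and to differentiability
in the next lemma. -/
lemma continuousOn_of_integral_eq (hF : Monotone fun u : Set.Icc (0 : ℝ) 1 => F u)
    (hq : Antitone q) (hq1 : ∀ t, q t ∈ Set.Icc (0 : ℝ) 1)
    (heq : ∀ t, 0 ≤ t → q t = Real.exp (-t) * (1 + ∫ s in (0 : ℝ)..t, Real.exp s * F (q s))) :
    ContinuousOn q (Set.Ici 0) := by
  have hanti : Antitone fun s => F (q s) := fun s t h =>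
    hF (a := ⟨q t, hq1 t⟩) (b := ⟨q s, hq1 s⟩) (hq h)
  have hint : ∀ a b, IntervalIntegrable (fun s => Real.exp s * F (q s)) volume a b := fun a b =>
    (hanti.intervalIntegrable).continuousOn_mul (Real.continuous_exp.continuousOn)
  have hc := intervalIntegral.continuous_primitive hint 0
  refine ContinuousOn.congr (f := fun t => Real.exp (-t) *
    (1 + ∫ s in (0 : ℝ)..t, Real.exp s * F (q s))) ?_ fun t ht => heq t ht
  exact Continuous.continuousOn (by fun_prop)

lemma hasDerivAt_of_integral_eq (hF : Monotone fun u : Set.Icc (0 : ℝ) 1 => F u)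
    (hFc : ContinuousOn F (Set.Icc 0 1))
    (hq : Antitone q) (hq1 : ∀ t, q t ∈ Set.Icc (0 : ℝ) 1)
    (heq : ∀ t, 0 ≤ t → q t = Real.exp (-t) * (1 + ∫ s in (0 : ℝ)..t, Real.exp s * F (q s)))
    {t : ℝ} (ht : 0 < t) : HasDerivAt q (F (q t) - q t) t := by
  have hanti : Antitone fun s => F (q s) := fun s t h =>
    hF (a := ⟨q t, hq1 t⟩) (b := ⟨q s, hq1 s⟩) (hq h)
  have hint : ∀ a b, IntervalIntegrable (fun s => Real.exp s * F (q s)) volume a b := fun a b =>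
    (hanti.intervalIntegrable).continuousOn_mul (Real.continuous_exp.continuousOn)
  have hqc : ContinuousAt q t :=
    (continuousOn_of_integral_eq hF hq hq1 heq).continuousAt (Ici_mem_nhds ht)
  have hFq : ContinuousAt (fun s => F (q s)) t := by
    have := (hFc (q t) (hq1 t)).tendsto.comp
      (tendsto_nhdsWithin_iff.2 ⟨hqc.tendsto, Filter.Eventually.of_forall hq1⟩)
    exact this
  have hmeas : Measurable fun s => Real.exp s * F (q s) :=
    Real.measurable_exp.mul hanti.measurable
  have h1 : HasDerivAt (fun t => ∫ s in (0 : ℝ)..t, Real.exp s * F (q s))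
      (Real.exp t * F (q t)) t :=
    intervalIntegral.integral_hasDerivAt_right (hint 0 t)
      hmeas.stronglyMeasurable.stronglyMeasurableAtFilter
      (Real.continuous_exp.continuousAt.mul hFq)
  have h2 : HasDerivAt (fun t : ℝ => Real.exp (-t)) (-Real.exp (-t)) t := by
    simpa using (hasDerivAt_neg t).exp
  have h3 := h2.mul (h1.const_add 1)
  have h4 : HasDerivAt q _ t := h3.congr_of_eventuallyEq
    (Filter.eventually_of_mem (Ici_mem_nhds ht) fun s hs => heq s hs)
  convert h4 using 1
  have h5 := heq t ht.le
  have h6 : Real.exp (-t) * Real.exp t = 1 := by rw [← Real.exp_add]; simp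
  linear_combination (-1) * h5 - F (q t) * h6

/-- Osgood's uniqueness argument for `q' = F(q) - q` at the fixed point 1: a solution that leaves 1
would cross an interval `(1 - ε, 1)` in finite time. -/
lemma eq_one_of_integral_eq (hF : Monotone fun u : Set.Icc (0 : ℝ) 1 => F u)
    (hFc : ContinuousOn F (Set.Icc 0 1))
    (hq : Antitone q) (hq1 : ∀ t, q t ∈ Set.Icc (0 : ℝ) 1)
    (heq : ∀ t, 0 ≤ t → q t = Real.exp (-t) * (1 + ∫ s in (0 : ℝ)..t, Real.exp s * F (q s)))
    (hinf : ∀ ε : ℝ, 0 < ε → ε < 1 →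
      ∫⁻ u in Set.Ioo (1 - ε) 1, (ENNReal.ofReal |F u - u|)⁻¹ = ∞) {t : ℝ} (ht : 0 ≤ t) :
    q t = 1 := by
  by_contra hne
  have hlt : q t < 1 := lt_of_le_of_ne (hq1 t).2 hne
  have hcont := continuousOn_of_integral_eq hF hq hq1 heq
  have hderiv := fun s hs => hasDerivAt_of_integral_eq hF hFc hq hq1 heq (t := s) hs
  have hcont' : ContinuousOn q (Set.Icc 0 t) := hcont.mono Set.Icc_subset_Ici_self
  have h0 : q 0 = 1 := by simpa using heq 0 le_rfl
  have hK : IsCompact (Set.Icc 0 t ∩ q ⁻¹' {1}) :=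
    isCompact_Icc.of_isClosed_subset (hcont'.preimage_isClosed_of_isClosed isClosed_Icc
      isClosed_singleton) Set.inter_subset_left
  -- The last time before `t` at which `q` equals 1, attained by compactness.
  set a := sSup (Set.Icc 0 t ∩ q ⁻¹' {1}) with ha
  have haK : a ∈ Set.Icc 0 t ∩ q ⁻¹' {1} := hK.sSup_mem ⟨0, ⟨le_rfl, ht⟩, h0⟩
  have hqa : q a = 1 := haK.2
  have ha0 : 0 ≤ a := haK.1.1
  have hat : a < t := lt_of_le_of_ne haK.1.2 fun h => hne (h ▸ hqa)
  have hlt1 : ∀ s, a < s → s ≤ t → q s < 1 := fun s hs hst =>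
    lt_of_le_of_ne (hq1 s).2 fun h =>
      not_lt.2 (le_csSup hK.bddAbove ⟨⟨ha0.trans hs.le, hst⟩, h⟩) hs
  -- A flat piece of `q` would sit at a fixed point of `F`, which a solution coming from 1 cannot
  -- reach in finite time.
  have hinj' : ∀ b c, a < b → b < c → c < t → q b ≠ q c := by
    intro b c hb hbc hct h
    have hconst : ∀ s ∈ Set.Icc b c, q s = q c := fun s hs =>
      le_antisymm (h ▸ hq hs.1) (hq hs.2)
    have hmid : (b + c) / 2 ∈ Set.Ioo b c := ⟨by linarith, by linarith⟩
    have hfix : F (q c) = q c := by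
      have h1 := hderiv ((b + c) / 2) (by linarith [hmid.1])
      have h2 : HasDerivAt q 0 ((b + c) / 2) :=
        (hasDerivAt_const _ (q c)).congr_of_eventuallyEq
          (Filter.eventually_of_mem (Icc_mem_nhds hmid.1 hmid.2) hconst)
      have h3 := h1.unique h2
      rw [hconst _ (Set.Ioo_subset_Icc_self hmid)] at h3
      linarith
    -- Since `F (q c) = q c`, the derivative is `exp s * (F (q s) - F (q c))`, nonnegative because
    -- `q s ≥ q c`. Comparing `a` with `c` gives `q a ≤ q c`, although `q a = 1 > q c`.
    have hmono : MonotoneOn (fun s => Real.exp s * (q s - q c)) (Set.Icc a c) := by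
      refine monotoneOn_of_deriv_nonneg (convex_Icc a c) ?_ ?_ ?_
      · refine Real.continuous_exp.continuousOn.mul ((hcont.mono fun s hs => ?_).sub
          continuousOn_const)
        exact ha0.trans hs.1
      · rw [interior_Icc]
        intro s hs
        exact ((Real.hasDerivAt_exp s).mul ((hderiv s (ha0.trans_lt hs.1)).sub_const
          (q c))).differentiableAt.differentiableWithinAt
      · rw [interior_Icc]
        intro s hs
        have := ((Real.hasDerivAt_exp s).mul ((hderiv s (ha0.trans_lt hs.1)).sub_const (q c))).deriv
        change 0 ≤ deriv (Real.exp * fun x => q x - q c) s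
        rw [this]
        have hFm : F (q c) ≤ F (q s) := hF (a := ⟨q c, hq1 c⟩) (b := ⟨q s, hq1 s⟩) (hq hs.2.le)
        have : Real.exp s * (q s - q c) + Real.exp s * (F (q s) - q s) =
          Real.exp s * (F (q s) - F (q c)) := by rw [hfix]; ring
        rw [this]
        exact mul_nonneg (Real.exp_pos s).le (sub_nonneg.2 hFm)
    have h1 := hmono ⟨le_rfl, (hb.trans hbc).le⟩ ⟨(hb.trans hbc).le, le_rfl⟩ (hb.trans hbc).le
    simp only [hqa, sub_self, mul_zero] at h1
    exact absurd h1 (not_le.2 (mul_pos (Real.exp_pos a)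
      (sub_pos.2 (hlt1 c (hb.trans hbc) hct.le))))
  have hinj : Set.InjOn q (Set.Ioo a t) := by
    intro b hb c hc h
    rcases lt_trichotomy b c with h' | h' | h'
    · exact absurd h (hinj' b c hb.1 h' hc.2)
    · exact h'
    · exact absurd h.symm (hinj' c b hc.1 h' hb.2)
  have hchange := lintegral_image_eq_lintegral_abs_deriv_mul (f := q)
    (f' := fun s => F (q s) - q s) measurableSet_Ioo
    (fun s hs => (hderiv s (ha0.trans_lt hs.1)).hasDerivWithinAt) hinj
    (fun u => (ENNReal.ofReal |F u - u|)⁻¹)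
  have hle : ∫⁻ u in q '' Set.Ioo a t, (ENNReal.ofReal |F u - u|)⁻¹ < ∞ := by
    rw [hchange]
    -- The Jacobian cancels the integrand; the bound by 1 also covers the points where the
    -- derivative vanishes.
    calc _ ≤ ∫⁻ _ in Set.Ioo a t, 1 := lintegral_mono fun s => ENNReal.mul_inv_le_one _
      _ < ∞ := by simp
  -- The half keeps `ε = (1 - q t) / 2` below 1 even if `q t = 0`.
  have hsub : Set.Ioo (1 - (1 - q t) / 2) 1 ⊆ q '' Set.Ioo a t := by
    have := intermediate_value_Ioo' hat.le (hcont.mono fun s hs => ha0.trans hs.1)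
    rw [hqa] at this
    refine (Set.Ioo_subset_Ioo_left ?_).trans this
    linarith
  have h2 := hinf ((1 - q t) / 2) (by linarith) (by linarith [(hq1 t).1])
  exact absurd h2 ((lintegral_mono_set hsub).trans_lt hle).ne

end ODE

end

section

/-! ### The law of the noise -/

instance : IsProbabilityMeasure (expMeasure 1) := isProbabilityMeasure_expMeasure one_pos

lemma expMeasure_one_eq : expMeasure 1 =
    (volume.restrict (Set.Ioi 0)).withDensity fun e => ENNReal.ofReal (Real.exp (-e)) := by
  have h : gammaPDF 1 1 = (Set.Ici (0 : ℝ)).indicator fun e => ENNReal.ofReal (Real.exp (-e)) := by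
    funext e
    by_cases he : 0 ≤ e <;> simp [gammaPDF, gammaPDFReal, he]
  rw [expMeasure, gammaMeasure, h, withDensity_indicator measurableSet_Ici,
    Measure.restrict_congr_set Ioi_ae_eq_Ici]

lemma ae_pos_expMeasure : ∀ᵐ e ∂expMeasure 1, 0 < e := by
  rw [expMeasure_one_eq]
  exact (withDensity_absolutelyContinuous _ _).ae_le (ae_restrict_mem measurableSet_Ioi)

lemma integral_expMeasure (f : ℝ → ℝ) :
    ∫ e, f e ∂expMeasure 1 = ∫ e in Set.Ioi 0, Real.exp (-e) * f e := by
  rw [expMeasure_one_eq, integral_withDensity_eq_integral_toReal_smul (by fun_prop) (by simp)]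
  simp [Real.exp_nonneg]

/-- The law of the noise when `mY` is the law of the sequences of ratios. -/
abbrev treeLaw (mY : Measure (ℕ → ℝ)) : Measure Noise := noiseLaw (mY.prod (expMeasure 1))

variable {mY : Measure (ℕ → ℝ)} {ν : Measure PointMeasure}

lemma ae_isGood [IsProbabilityMeasure mY] (h : HasSequenceLaw mY ν fun i y => y i) : ∀ᵐ W ∂treeLaw mY, IsGood W := by
  have h1 : ∀ u : Node, ∀ᵐ W ∂treeLaw mY,
      (∃ n : ℕ, ∀ i, 0 ≤ (W u).1 i ∧ ((W u).1 i = 0 ↔ n ≤ i)) ∧ 0 < (W u).2 := fun u => by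
    have hmp := measurePreserving_eval_infinitePi (fun _ : Node => mY.prod (expMeasure 1)) u
    have h2 : ∀ᵐ a ∂mY.prod (expMeasure 1),
        (∃ n : ℕ, ∀ i, 0 ≤ a.1 i ∧ (a.1 i = 0 ↔ n ≤ i)) ∧ 0 < a.2 :=
      (Measure.quasiMeasurePreserving_fst.ae h.1).and
        (Measure.quasiMeasurePreserving_snd.ae ae_pos_expMeasure)
    exact hmp.quasiMeasurePreserving.ae h2
  filter_upwards [ae_all_iff.2 h1] with W hW
  refine ⟨fun u i => ?_, fun u => (hW u).2.le, fun u => ?_⟩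
  · obtain ⟨n, hn⟩ := (hW u).1
    exact (hn i).1
  · obtain ⟨n, hn⟩ := (hW u).1
    exact ⟨n, fun i => (hn i).2⟩

/-! ### The offspring measure of a sequence -/

lemma sequenceMeasure_eq (z : ℕ → ℝ) :
    sequenceMeasure z = diracSum (fun i => 0 < z i) fun i => toPos (z i) := by
  classical
  rw [sequenceMeasure, diracSum]
  congr 1
  funext i
  split_ifs with h
  · rw [toPos_of_pos h]
  · rfl

lemma measurable_offspring_measure :
    Measurable fun y : ℕ → ℝ => toPointMeasure (sequenceMeasure y) := by
  simp only [sequenceMeasure_eq]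
  exact measurable_toPointMeasure_diracSum
    (fun i => measurableSet_lt measurable_const (measurable_pi_apply i))
    fun i => measurable_toPos.comp (measurable_pi_apply i)

lemma finite_pos {y : ℕ → ℝ} {n : ℕ} (hn : ∀ i, 0 ≤ y i ∧ (y i = 0 ↔ n ≤ i)) :
    {i | 0 < y i} = ((Finset.range n : Finset ℕ) : Set ℕ) := by
  ext i
  have := hn i
  simp only [Set.mem_ofPred_eq, Finset.coe_range, Set.mem_Iio]
  rw [← not_le (a := n), ← (hn i).2]
  exact ⟨fun h => h.ne', fun h => lt_of_le_of_ne (hn i).1 (Ne.symm h)⟩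

lemma toPointMeasure_sequenceMeasure {y : ℕ → ℝ} {n : ℕ}
    (hn : ∀ i, 0 ≤ y i ∧ (y i = 0 ↔ n ≤ i)) :
    toPointMeasure (sequenceMeasure y) = ∑ i ∈ Finset.range n, atom (toPos (y i)) := by
  have h : {i | 0 < y i}.Finite := by rw [finite_pos hn]; exact Finset.finite_toSet _
  rw [sequenceMeasure_eq, toPointMeasure_diracSum _ _ h]
  congr 1
  ext i
  rw [Set.Finite.mem_toFinset, finite_pos hn, Finset.mem_coe]

lemma real_univ_toPointMeasure_sequenceMeasure {y : ℕ → ℝ} {n : ℕ}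
    (hn : ∀ i, 0 ≤ y i ∧ (y i = 0 ↔ n ≤ i)) :
    ((toPointMeasure (sequenceMeasure y) : PointMeasure) : Measure PosReal).real Set.univ = n := by
  rw [toPointMeasure_sequenceMeasure hn, measureReal_def]
  simp

lemma measurable_rpow_count (u : ℝ) : Measurable fun s : PointMeasure =>
    u ^ ((s : Measure PosReal).real Set.univ) :=
  (measurable_coe_apply .univ).ennreal_toReal.const_pow u

lemma genFun_eq (h : HasSequenceLaw mY ν fun i y => y i) (u : ℝ) :
    genFun ν u = ∫ y, u ^ (((toPointMeasure (sequenceMeasure y) : PointMeasure) :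
      Measure PosReal).real Set.univ) ∂mY := by
  rw [genFun, ← h.2, integral_map measurable_offspring_measure.aemeasurable
    (measurable_rpow_count u).aestronglyMeasurable]

lemma powerMoment_eq (h : HasSequenceLaw mY ν fun i y => y i) {p : ℝ} (hp : 0 < p) :
    powerMoment ν p = ∫⁻ y, ∑' i, ENNReal.ofReal (y i ^ p) ∂mY := by
  have hm : Measurable fun x : PosReal => ENNReal.ofReal ((x : ℝ) ^ p) := by fun_prop
  have hm2 : Measurable fun s : PointMeasure =>
      ∫⁻ x, ENNReal.ofReal ((x : ℝ) ^ p) ∂(s : Measure PosReal) :=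
    (Measure.measurable_lintegral hm).comp measurable_subtype_coe
  rw [powerMoment, ← h.2, lintegral_map hm2 measurable_offspring_measure]
  refine lintegral_congr_ae ?_
  filter_upwards [h.1] with y ⟨n, hn⟩
  rw [toPointMeasure_sequenceMeasure hn, AddSubmonoid.coe_finsetSum,
    lintegral_finsetSum_measure, tsum_eq_sum (s := Finset.range n)]
  · refine Finset.sum_congr rfl fun i hi => ?_
    have : 0 < y i := by
      have := (finite_pos hn).symm.subset (Finset.mem_coe.2 hi)
      exact this
    rw [coe_atom, lintegral_dirac' _ hm, toPos_of_pos this]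
  · intro i hi
    -- Positivity of `p` matters here: the zero terms of the sequence must contribute nothing.
    rw [(hn i).2.2 (by simpa using hi), Real.zero_rpow hp.ne', ENNReal.ofReal_zero]

/-! ### Regularity of the generating function -/

section GenFun

variable [IsProbabilityMeasure ν]

lemma norm_rpow_le_one {u c : ℝ} (hu : u ∈ Set.Icc (0 : ℝ) 1) (hc : 0 ≤ c) : ‖u ^ c‖ ≤ 1 := by
  rw [Real.norm_eq_abs, abs_of_nonneg (Real.rpow_nonneg hu.1 _)]
  exact Real.rpow_le_one hu.1 hu.2 hc

lemma integrable_rpow_count {u : ℝ} (hu : u ∈ Set.Icc (0 : ℝ) 1) :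
    Integrable (fun s : PointMeasure => u ^ ((s : Measure PosReal).real Set.univ)) ν :=
  .of_bound (measurable_rpow_count u).aestronglyMeasurable 1
    (.of_forall fun _ => norm_rpow_le_one hu measureReal_nonneg)

variable (ν) in
lemma monotone_genFun : Monotone fun u : Set.Icc (0 : ℝ) 1 => genFun ν u := fun u v huv =>
  integral_mono (integrable_rpow_count u.2) (integrable_rpow_count v.2) fun _ =>
    Real.rpow_le_rpow u.2.1 huv measureReal_nonneg

lemma exists_nat_count (s : PointMeasure) : ∃ n : ℕ, (s : Measure PosReal).real Set.univ = n := by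
  obtain ⟨l, rfl⟩ := exists_eq_sum_atom s
  refine ⟨l.length, ?_⟩
  induction l with
  | nil => simp
  | cons a l ih =>
    rw [List.map_cons, List.sum_cons, AddSubmonoid.coe_add, measureReal_add_apply, ih]
    simp [add_comm]

variable (ν) in
lemma continuousOn_genFun : ContinuousOn (genFun ν) (Set.Icc 0 1) := by
  refine continuousOn_of_dominated (bound := fun _ => 1)
    (fun u _ => (measurable_rpow_count u).aestronglyMeasurable)
    (fun u hu => .of_forall fun s => norm_rpow_le_one hu measureReal_nonneg)
    (integrable_const _) (.of_forall fun s => ?_)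
  obtain ⟨n, hn⟩ := exists_nat_count s
  simp only [hn, Real.rpow_natCast]
  fun_prop

variable (ν) in
lemma genFun_one : genFun ν 1 = 1 := by simp [genFun]

end GenFun

end

section

/-! ### Decomposition at the root -/

lemma size_join_concat (x : ℝ) (a : Mark) (V : ℕ → Noise) (v : Node) (i : ℕ) :
    size x (ratios (join (a, V))) (v ++ [i]) = size (a.1 i * x) (ratios (V i)) v := by
  rw [size_append]
  simp only [size]
  congr 1
  funext w j
  simp [ratios]

lemma birth_join_concat (α x : ℝ) (a : Mark) (V : ℕ → Noise) (v : Node) (i : ℕ) :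
    birth α x (ratios (join (a, V))) (clocks (join (a, V))) (v ++ [i]) =
      x ^ (-α) * a.2 + birth α (a.1 i * x) (ratios (V i)) (clocks (V i)) v := by
  rw [birth_append]
  simp only [size, birth, lifetime, zero_add, clocks, join_nil]
  congr 2
  · funext w j
    simp [ratios]
  · funext w
    simp

lemma size_eq_mul (x : ℝ) (y : Node → ℕ → ℝ) (u : Node) : size x y u = x * size 1 y u := by
  induction u with
  | nil => simp [size]
  | cons i u ih => simp only [size]; rw [ih]; ring

lemma birth_zero (x : ℝ) (y : Node → ℕ → ℝ) (e : Node → ℝ) (u : Node) :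
    birth 0 x y e u = birth 0 1 y e u := by
  induction u with
  | nil => rfl
  | cons i u ih => simp [birth, lifetime, ih]

/-- The nodes of positive size that are born before time `t`. -/
def born (α x : ℝ) (W : Noise) (t : ℝ) : Set Node :=
  {u | 0 < size x (ratios W) u ∧ birth α x (ratios W) (clocks W) u ≤ t}

lemma measurableSet_born (α x t : ℝ) (u : Node) : MeasurableSet {W : Noise | u ∈ born α x W t} := by
  have hm : Measurable fun W : Noise => ((x, W) : ℝ × Noise) := by fun_prop
  exact hm ((measurableSet_lt measurable_const (measurable_size u)).inter
    (measurableSet_le (measurable_birth α u) measurable_const))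

lemma measurableSet_finite {β ι : Type*} [MeasurableSpace β] [Countable ι] {p : β → ι → Prop}
    (hp : ∀ i, MeasurableSet {b | p b i}) : MeasurableSet {b | {i | p b i}.Finite} := by
  have : {b | {i | p b i}.Finite} = ⋃ K : Finset ι, ⋂ i ∈ (K : Set ι)ᶜ, {b | p b i}ᶜ := by
    ext b
    simp only [Set.mem_ofPred_eq, Set.mem_iUnion, Set.mem_iInter, Set.mem_compl_iff]
    constructor
    · intro h
      exact ⟨h.toFinset, fun i hi hp => hi (by simpa using hp)⟩
    · rintro ⟨K, hK⟩
      exact K.finite_toSet.subset fun i hi => by_contra fun h => hK i h hi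
  rw [this]
  exact .iUnion fun K => .biInter (Set.to_countable _) fun i _ => (hp i).compl

/-- The noises for which finitely many nodes are born before time `t` when `α = 0`. -/
def finiteBorn (t : ℝ) : Set Noise := {W | (born 0 1 W t).Finite}

lemma measurableSet_finiteBorn (t : ℝ) : MeasurableSet (finiteBorn t) :=
  measurableSet_finite (p := fun W u => u ∈ born 0 1 W t) (measurableSet_born 0 1 t)

lemma concat_mem_born {a : Mark} {V : ℕ → Noise} {t : ℝ} {i : ℕ} (hi : 0 < a.1 i) (v : Node) :
    v ++ [i] ∈ born 0 1 (join (a, V)) t ↔ v ∈ born 0 1 (V i) (t - a.2) := by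
  simp only [born, Set.mem_ofPred_eq, size_join_concat, birth_join_concat]
  rw [size_eq_mul, birth_zero]
  simp [hi, le_sub_iff_add_le']

/-- Apart from the root, the born nodes split among the `n` children of positive size, whose
subtrees start at time `a.2`; a finite union of finite sets is finite. -/
lemma join_mem_finiteBorn {a : Mark} {V : ℕ → Noise} {n : ℕ}
    (hn : ∀ i, 0 ≤ a.1 i ∧ (a.1 i = 0 ↔ n ≤ i)) (t : ℝ) :
    join (a, V) ∈ finiteBorn t ↔ ∀ i ∈ Finset.range n, V i ∈ finiteBorn (t - a.2) := by
  have hpos : ∀ i, 0 < a.1 i ↔ i ∈ Finset.range n := fun i => Set.ext_iff.1 (finite_pos hn) i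
  constructor
  · intro h i hi
    refine (h.preimage (f := fun v : Node => v ++ [i])
      (Function.Injective.injOn fun v w h => by simpa using h)).subset fun v hv => ?_
    exact (concat_mem_born ((hpos i).2 hi) v).2 hv
  · intro h
    refine ((Set.finite_singleton ([] : Node)).union (Set.Finite.biUnion
      (Finset.range n).finite_toSet fun i hi => (h i hi).image fun v => v ++ [i])).subset ?_
    intro u hu
    rcases List.eq_nil_or_concat' u with rfl | ⟨v, i, rfl⟩
    · exact .inl rfl
    · have hi : 0 < a.1 i := by
        have := hu.1
        rw [size_join_concat, size_eq_mul, mul_one] at this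
        exact lt_of_le_of_ne (hn i).1 fun h0 => by simp [← h0] at this
      exact .inr (Set.mem_biUnion (Finset.mem_coe.2 ((hpos i).1 hi))
        ⟨v, (concat_mem_born hi v).1 hu, rfl⟩)

/-! ### No explosion when `α = 0` -/

variable {mY : Measure (ℕ → ℝ)} [IsProbabilityMeasure mY] {ν : Measure PointMeasure}

variable (mY) in
/-- The probability that finitely many nodes are born before time `t` when `α = 0`. -/
def finiteProb (t : ℝ) : ℝ := (treeLaw mY).real (finiteBorn t)

lemma finiteProb_mem (t : ℝ) : finiteProb mY t ∈ Set.Icc (0 : ℝ) 1 :=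
  ⟨measureReal_nonneg, measureReal_le_one⟩

lemma antitone_finiteProb : Antitone (finiteProb mY) := fun _ _ hst =>
  measureReal_mono fun _ hW => hW.subset fun _ hu => ⟨hu.1, hu.2.trans hst⟩

lemma finiteProb_of_neg (h : HasSequenceLaw mY ν fun i y => y i) {t : ℝ} (ht : t < 0) :
    finiteProb mY t = 1 := by
  have : ∀ᵐ W ∂treeLaw mY, W ∈ finiteBorn t := by
    filter_upwards [ae_isGood h] with W hW
    have : born 0 1 W t = ∅ := by
      rw [Set.eq_empty_iff_forall_notMem]
      intro u hu
      exact absurd ((birth_nonneg zero_le_one hW.ratios_nonneg hW.clocks_nonneg u).trans hu.2)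
        (not_le.2 ht)
    rw [finiteBorn, Set.mem_ofPred_eq, this]
    exact Set.finite_empty
  rw [finiteProb, measureReal_def, prob_compl_eq_zero_iff (measurableSet_finiteBorn t) |>.1 this]
  rfl

lemma measure_join {S : Set Noise} (hS : MeasurableSet S) :
    treeLaw mY S = ∫⁻ a, (Measure.infinitePi fun _ : ℕ => treeLaw mY) {V | join (a, V) ∈ S}
      ∂(mY.prod (expMeasure 1)) := by
  have h := map_join (mY.prod (expMeasure 1))
  have : treeLaw mY S = ((mY.prod (expMeasure 1)).prod
      (Measure.infinitePi fun _ : ℕ => treeLaw mY)) (join ⁻¹' S) := by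
    rw [← Measure.map_apply measurable_join hS, h]
  rw [this, Measure.prod_apply (measurable_join hS)]
  rfl

/-- Given the clock `e` and the number `n` of children of the root, the `n` subtrees are
independent, so the conditional probability is `q(t - e) ^ n`; averaging over `n` gives `F(q(t -
e))`. -/
lemma finiteProb_eq_integral [IsProbabilityMeasure ν] (h : HasSequenceLaw mY ν fun i y => y i)
    (t : ℝ) : finiteProb mY t = ∫ e, genFun ν (finiteProb mY (t - e)) ∂expMeasure 1 := by
  set N : (ℕ → ℝ) → ℝ := fun y => ((toPointMeasure (sequenceMeasure y) : PointMeasure) :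
    Measure PosReal).real Set.univ with hN
  have hNm : Measurable N :=
    ((measurable_coe_apply .univ).comp measurable_offspring_measure).ennreal_toReal
  have hqm : Measurable (finiteProb mY) := antitone_finiteProb.measurable
  have h1 : ∀ᵐ a ∂mY.prod (expMeasure 1),
      (Measure.infinitePi fun _ : ℕ => treeLaw mY) {V | join (a, V) ∈ finiteBorn t} =
        ENNReal.ofReal (finiteProb mY (t - a.2) ^ N a.1) := by
    filter_upwards [Measure.quasiMeasurePreserving_fst.ae h.1] with a ⟨n, hn⟩
    have : {V : ℕ → Noise | join (a, V) ∈ finiteBorn t} =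
        Set.pi (Finset.range n) fun _ => finiteBorn (t - a.2) := by
      ext V
      simp only [Set.mem_ofPred_eq, join_mem_finiteBorn hn, Set.mem_pi, Finset.mem_coe]
    rw [this, Measure.infinitePi_pi _ fun _ _ => measurableSet_finiteBorn _]
    have : N a.1 = n := real_univ_toPointMeasure_sequenceMeasure hn
    rw [this, Finset.prod_const, Finset.card_range, Real.rpow_natCast,
      ENNReal.ofReal_pow (finiteProb_mem _).1, finiteProb, ofReal_measureReal]
  have hm : Measurable fun a : Mark => finiteProb mY (t - a.2) ^ N a.1 :=
    (hqm.comp (measurable_const.sub measurable_snd)).pow (hNm.comp measurable_fst)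
  have hint : Integrable (fun a : Mark => finiteProb mY (t - a.2) ^ N a.1)
      (mY.prod (expMeasure 1)) :=
    .of_bound hm.aestronglyMeasurable 1
      (.of_forall fun a => norm_rpow_le_one (finiteProb_mem _) measureReal_nonneg)
  rw [finiteProb, measureReal_def, measure_join (measurableSet_finiteBorn t), lintegral_congr_ae h1,
    ← integral_eq_lintegral_of_nonneg_ae
      (.of_forall fun a => Real.rpow_nonneg (finiteProb_mem _).1 _) hm.aestronglyMeasurable,
    integral_prod_symm _ hint]
  simp only [genFun_eq h, hN]

lemma finiteProb_eq [IsProbabilityMeasure ν] (h : HasSequenceLaw mY ν fun i y => y i)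
    {t : ℝ} (ht : 0 ≤ t) : finiteProb mY t =
      Real.exp (-t) * (1 + ∫ s in (0 : ℝ)..t, Real.exp s * genFun ν (finiteProb mY s)) := by
  have hanti : Antitone fun s => genFun ν (finiteProb mY s) := fun s t h =>
    monotone_genFun ν (a := ⟨_, finiteProb_mem t⟩) (b := ⟨_, finiteProb_mem s⟩)
      (antitone_finiteProb h)
  have hmono : Monotone fun e => genFun ν (finiteProb mY (t - e)) := fun a b hab =>
    hanti (sub_le_sub_left hab t)
  have hint1 : IntegrableOn (fun e => Real.exp (-e) * genFun ν (finiteProb mY (t - e)))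
      (Set.Ioc 0 t) := by
    rw [← intervalIntegrable_iff_integrableOn_Ioc_of_le ht]
    exact hmono.intervalIntegrable.continuousOn_mul (by fun_prop)
  -- If the root outlives `t`, its children are born too late and `F(1) = 1`: this part contributes
  -- `exp (-t)`, the constant term of the equation.
  have hEq : Set.EqOn (fun e => Real.exp (-e) * genFun ν (finiteProb mY (t - e)))
      (fun e => Real.exp (-e)) (Set.Ioi t) := fun e he => by
    have : finiteProb mY (t - e) = 1 := finiteProb_of_neg h (sub_neg.2 he)
    simp only [this, genFun_one, mul_one]
  have hint2 : IntegrableOn (fun e => Real.exp (-e) * genFun ν (finiteProb mY (t - e)))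
      (Set.Ioi t) :=
    (integrableOn_congr_fun hEq measurableSet_Ioi).2 (integrableOn_exp_neg_Ioi t)
  rw [finiteProb_eq_integral h, integral_expMeasure, ← Set.Ioc_union_Ioi_eq_Ioi ht,
    setIntegral_union (Set.Ioc_disjoint_Ioi le_rfl) measurableSet_Ioi hint1 hint2,
    setIntegral_congr_fun measurableSet_Ioi hEq, integral_exp_neg_Ioi, add_comm, mul_add, mul_one,
    ← intervalIntegral.integral_of_le ht]
  congr 1
  -- Substitution `s = t - e`.
  have := intervalIntegral.integral_comp_sub_left (a := 0) (b := t)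
    (fun s => Real.exp (-(t - s)) * genFun ν (finiteProb mY s)) t
  simp only [sub_sub_cancel, sub_self, sub_zero] at this
  rw [this, ← intervalIntegral.integral_const_mul]
  refine intervalIntegral.integral_congr fun s _ => ?_
  rw [← mul_assoc, ← Real.exp_add]
  ring_nf

lemma ae_finiteBorn [IsProbabilityMeasure ν] (h : HasSequenceLaw mY ν fun i y => y i)
    (hF : NonExplosion ν) : ∀ᵐ W ∂treeLaw mY, ∀ t, W ∈ finiteBorn t := by
  have h1 : ∀ n : ℕ, ∀ᵐ W ∂treeLaw mY, W ∈ finiteBorn n := fun n => by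
    have h2 := eq_one_of_integral_eq (monotone_genFun ν) (continuousOn_genFun ν)
      antitone_finiteProb finiteProb_mem (fun t ht => finiteProb_eq h ht) hF n.cast_nonneg
    rw [finiteProb, measureReal_def, ENNReal.toReal_eq_one_iff] at h2
    exact (prob_compl_eq_zero_iff (measurableSet_finiteBorn n)).2 h2
  filter_upwards [ae_all_iff.2 h1] with W hW t
  obtain ⟨n, hn⟩ := exists_nat_ge t
  exact (hW n).subset fun u hu => ⟨hu.1, hu.2.trans hn⟩

end

section

/-! ### Boundedness of the sizes -/

/-- The noises for which some node among the first `n` generations has size above `C`. -/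
def exceeds (n : ℕ) (C x : ℝ) : Set Noise := {W | ∃ u : Node, u.length ≤ n ∧ C < size x (ratios W) u}

lemma measurableSet_exceeds (n : ℕ) (C : ℝ) :
    MeasurableSet {p : ℝ × Noise | p.2 ∈ exceeds n C p.1} := by
  have : {p : ℝ × Noise | p.2 ∈ exceeds n C p.1} =
      ⋃ (u : Node) (_ : u.length ≤ n), {p : ℝ × Noise | C < size p.1 (ratios p.2) u} := by
    ext p; simp [exceeds]
  rw [this]
  exact .iUnion fun u => .iUnion fun _ => measurableSet_lt measurable_const (measurable_size u)

lemma measurableSet_exceeds_right (n : ℕ) (C x : ℝ) : MeasurableSet (exceeds n C x) :=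
  measurable_prodMk_left (measurableSet_exceeds n C)

variable {mY : Measure (ℕ → ℝ)} [IsProbabilityMeasure mY] {ν : Measure PointMeasure}

/-- Induction on the generation, for all starting sizes at once because the `i`-th child restarts
from `a.1 i * x`. The union bound over the children yields the factor `∑ i, (a.1 i) ^ p`, of mean at
most 1. For `x > C` the bound exceeds 1. -/
lemma measure_exceeds_le (h : HasSequenceLaw mY ν fun i y => y i) {p : ℝ} (hp : 0 < p)
    (hm : powerMoment ν p ≤ 1) {C : ℝ} (hC : 0 < C) (n : ℕ) :
    ∀ x : ℝ, 0 ≤ x → treeLaw mY (exceeds n C x) ≤ ENNReal.ofReal ((x / C) ^ p) := by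
  have hbig : ∀ (n : ℕ) (x : ℝ), C < x →
      treeLaw mY (exceeds n C x) ≤ ENNReal.ofReal ((x / C) ^ p) := fun n x hx => by
    refine prob_le_one.trans ?_
    rw [ENNReal.one_le_ofReal]
    exact Real.one_le_rpow ((one_le_div hC).2 hx.le) hp.le
  induction n with
  | zero =>
    intro x hx
    rcases lt_or_ge C x with h' | h'
    · exact hbig 0 x h'
    · have : exceeds 0 C x = ∅ := by
        rw [Set.eq_empty_iff_forall_notMem]
        rintro W ⟨u, hu, hlt⟩
        have : u = [] := by simpa using hu
        subst this
        exact absurd hlt (not_lt.2 h')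
      rw [this]; simp
  | succ n ih =>
    intro x hx
    rcases lt_or_ge C x with h' | h'
    · exact hbig _ x h'
    rw [measure_join (measurableSet_exceeds_right _ _ _)]
    have h1 : ∀ᵐ a ∂mY.prod (expMeasure 1),
        (Measure.infinitePi fun _ : ℕ => treeLaw mY) {V | join (a, V) ∈ exceeds (n + 1) C x} ≤
          ENNReal.ofReal ((x / C) ^ p) * ∑' i, ENNReal.ofReal (a.1 i ^ p) := by
      filter_upwards [Measure.quasiMeasurePreserving_fst.ae h.1] with a ⟨k, hk⟩
      have hsub : {V : ℕ → Noise | join (a, V) ∈ exceeds (n + 1) C x} ⊆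
          ⋃ i, (fun V : ℕ → Noise => V i) ⁻¹' exceeds n C (a.1 i * x) := by
        rintro V ⟨u, hu, hlt⟩
        rcases List.eq_nil_or_concat' u with rfl | ⟨v, i, rfl⟩
        · exact absurd hlt (not_lt.2 h')
        · rw [size_join_concat] at hlt
          exact Set.mem_iUnion.2 ⟨i, v, by simpa using hu, hlt⟩
      refine (measure_mono hsub).trans ((measure_iUnion_le _).trans ?_)
      rw [← ENNReal.tsum_mul_left]
      refine ENNReal.tsum_le_tsum fun i => ?_
      rw [(measurePreserving_eval_infinitePi (fun _ : ℕ => treeLaw mY) i).measure_preimage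
        (measurableSet_exceeds_right _ _ _).nullMeasurableSet]
      refine (ih (a.1 i * x) (mul_nonneg (hk i).1 hx)).trans_eq ?_
      rw [← ENNReal.ofReal_mul (Real.rpow_nonneg (div_nonneg hx hC.le) _),
        ← Real.mul_rpow (div_nonneg hx hC.le) (hk i).1]
      congr 2
      ring
    have hmeas : Measurable fun y : ℕ → ℝ => ∑' i, ENNReal.ofReal (y i ^ p) :=
      Measurable.tsum fun i => ((measurable_pi_apply i).pow_const p).ennreal_ofReal
    have hmeas' : Measurable fun a : Mark => ∑' i, ENNReal.ofReal (a.1 i ^ p) :=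
      hmeas.comp measurable_fst
    refine (lintegral_mono_ae h1).trans ?_
    rw [lintegral_const_mul _ hmeas', lintegral_prod _ hmeas'.aemeasurable]
    simp only [lintegral_const, measure_univ, mul_one]
    rw [← powerMoment_eq h hp]
    exact mul_le_of_le_one_right' hm

lemma ae_size_bounded (h : HasSequenceLaw mY ν fun i y => y i) {p : ℝ} (hp : 0 < p)
    (hm : powerMoment ν p ≤ 1) {x : ℝ} (hx : 0 ≤ x) :
    ∀ᵐ W ∂treeLaw mY, ∃ C : ℝ, 0 < C ∧ ∀ u, size x (ratios W) u ≤ C := by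
  have h1 : ∀ k : ℕ, treeLaw mY {W | ¬ ∃ C : ℝ, 0 < C ∧ ∀ u, size x (ratios W) u ≤ C} ≤
      ENNReal.ofReal ((x / (k + 1 : ℝ)) ^ p) := fun k => by
    have hC : (0 : ℝ) < k + 1 := by positivity
    have hsub : {W | ¬ ∃ C : ℝ, 0 < C ∧ ∀ u, size x (ratios W) u ≤ C} ⊆
        ⋃ n, exceeds n (k + 1 : ℝ) x := fun W hW => by
      simp only [Set.mem_ofPred_eq] at hW
      push Not at hW
      obtain ⟨u, hu⟩ := hW (k + 1) hC
      exact Set.mem_iUnion.2 ⟨u.length, u, le_rfl, hu⟩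
    refine (measure_mono hsub).trans ?_
    have hmono : Monotone fun n => exceeds n (k + 1 : ℝ) x := fun n n' hn W ⟨u, hu, hlt⟩ =>
      ⟨u, hu.trans hn, hlt⟩
    rw [hmono.measure_iUnion]
    exact iSup_le fun n => measure_exceeds_le h hp hm hC n x hx
  have h2 : Filter.Tendsto (fun k : ℕ => ENNReal.ofReal ((x / (k + 1 : ℝ)) ^ p)) Filter.atTop
      (nhds 0) := by
    have h3 : Filter.Tendsto (fun k : ℕ => x / (k + 1 : ℝ)) Filter.atTop (nhds 0) :=
      tendsto_const_nhds.div_atTop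
        (Filter.tendsto_atTop_add_const_right _ _ tendsto_natCast_atTop_atTop)
    have h4 := ENNReal.tendsto_ofReal (h3.rpow_const (p := p) (.inr hp.le))
    simpa [Real.zero_rpow hp.ne'] using h4
  exact le_antisymm (ge_of_tendsto' h2 h1) zero_le

lemma exists_powerMoment_le_one [IsProbabilityMeasure ν] (hν : MalthusianHypotheses ν) :
    ∃ p : ℝ, 0 < p ∧ powerMoment ν p ≤ 1 := by
  obtain ⟨p, ⟨⟨hlow, hhigh, hk⟩, -⟩, hp, -⟩ := hν
  refine ⟨p, hp, ?_⟩
  -- Finiteness has to come first: for an infinite moment the integral defining `kappa` would take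
  -- the default value 0, a spurious zero. It follows from `pLow ν < p < pHigh ν`.
  have hfin : powerMoment ν p ≠ ∞ := fun htop =>
    not_le.2 hhigh (iInf_le_of_le p (iInf_le_of_le hlow (iInf_le_of_le htop le_rfl)))
  have hm : Measurable fun x : PosReal => (x : ℝ) ^ p := by fun_prop
  have hm1 : Measurable fun s : PointMeasure =>
      ∫⁻ x, ENNReal.ofReal ((x : ℝ) ^ p) ∂(s : Measure PosReal) :=
    (Measure.measurable_lintegral hm.ennreal_ofReal).comp measurable_subtype_coe
  have h1 : ∀ s : PointMeasure, ∫ x, (x : ℝ) ^ p ∂(s : Measure PosReal) =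
      (∫⁻ x, ENNReal.ofReal ((x : ℝ) ^ p) ∂(s : Measure PosReal)).toReal := fun s =>
    integral_eq_lintegral_of_nonneg_ae (.of_forall fun x => Real.rpow_nonneg x.2.le _)
      hm.aestronglyMeasurable
  have hint : Integrable (fun s : PointMeasure =>
      (∫⁻ x, ENNReal.ofReal ((x : ℝ) ^ p) ∂(s : Measure PosReal)).toReal) ν :=
    integrable_toReal_of_lintegral_ne_top hm1.aemeasurable hfin
  rw [kappa] at hk
  simp_rw [h1] at hk
  rw [integral_sub (integrable_const _) hint, integral_toReal hm1.aemeasurable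
    (ae_lt_top hm1 hfin)] at hk
  simp only [integral_const, probReal_univ, smul_eq_mul, mul_one] at hk
  change 1 - (powerMoment ν p).toReal = 0 at hk
  rw [← ENNReal.ofReal_toReal hfin, ENNReal.ofReal_le_one]
  linarith

/-! ### Finiteness of the population -/

/-- As `α ≥ 0`, a size at most `C` slows the clock by a factor at least `C ^ (-α)`. This compares
births with the case `α = 0`. -/
lemma mul_birth_zero_le {α x C : ℝ} (hα : 0 ≤ α) (hx : 0 < x) {W : Noise}
    (hW : IsGood W) (hbd : ∀ u, size x (ratios W) u ≤ C) {u : Node}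
    (hu : 0 < size x (ratios W) u) :
    C ^ (-α) * birth 0 1 (ratios W) (clocks W) u ≤ birth α x (ratios W) (clocks W) u := by
  induction u with
  | nil => simp [birth]
  | cons i u ih =>
    have hu' : 0 < size x (ratios W) u :=
      size_pos_of_append (v := [i]) hx.le hW.ratios_nonneg hu
    simp only [birth, lifetime, neg_zero, Real.rpow_zero, one_mul, mul_add]
    refine add_le_add (ih hu') (mul_le_mul_of_nonneg_right ?_ (hW.clocks_nonneg u))
    exact Real.rpow_le_rpow_of_nonpos hu' (hbd u) (neg_nonpos.2 hα)

lemma ae_finite_born [IsProbabilityMeasure ν] (h : HasSequenceLaw mY ν fun i y => y i)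
    (hν : MalthusianHypotheses ν) (hF : NonExplosion ν) {α x : ℝ} (hα : 0 ≤ α) (hx : 0 < x) :
    ∀ᵐ W ∂treeLaw mY, ∀ t, (born α x W t).Finite := by
  obtain ⟨p, hp, hm⟩ := exists_powerMoment_le_one hν
  filter_upwards [ae_isGood h, ae_finiteBorn h hF, ae_size_bounded h hp hm hx.le] with W hW hfin
    ⟨C, hC, hbd⟩ t
  refine (hfin (C ^ α * t)).subset fun u ⟨hu, hb⟩ => ⟨?_, ?_⟩
  · rw [size_eq_mul] at hu
    exact pos_of_mul_pos_right hu hx.le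
  · have h1 := (mul_birth_zero_le hα hx hW hbd hu).trans hb
    rwa [Real.rpow_neg hC.le, inv_mul_le_iff₀ (Real.rpow_pos_of_pos hC _)] at h1

lemma finite_alive {α x t : ℝ} {W : Noise} (h : (born α x W t).Finite) :
    {u | Alive α x (ratios W) (clocks W) t u}.Finite :=
  h.subset fun _ hu => ⟨hu.1, hu.2.1⟩

lemma treeX_eq_sum {α x t : ℝ} {W : Noise}
    (h : {u | Alive α x (ratios W) (clocks W) t u}.Finite) :
    treeX α t x W = ∑ u ∈ h.toFinset, atom (toPos (size x (ratios W) u)) := by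
  rw [treeX, pop_eq_diracSum, toPointMeasure_diracSum _ _ h]

lemma pop_mem_pointMeasures {α x t : ℝ} {W : Noise}
    (h : {u | Alive α x (ratios W) (clocks W) t u}.Finite) : pop α x t W ∈ pointMeasures := by
  rw [pop_eq_diracSum, diracSum_of_finite _ _ h]
  exact Subtype.coe_prop _

end

section

/-! ### Characters of the monoid of point measures -/

/-- Measurable bounded multiplicative functions on the monoid of finite point measures. -/
structure IsCharacter (g : PointMeasure → ℂ) : Prop where
  measurable : Measurable g
  norm_le : ∀ s, ‖g s‖ ≤ 1
  map_zero : g 0 = 1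
  map_add : ∀ s s', g (s + s') = g s * g s'

namespace IsCharacter

variable {g : PointMeasure → ℂ}

lemma map_sum (hg : IsCharacter g) {ι : Type*} (K : Finset ι) (f : ι → PointMeasure) :
    g (∑ i ∈ K, f i) = ∏ i ∈ K, g (f i) := by
  classical
  induction K using Finset.induction_on with
  | empty => simpa using hg.map_zero
  | insert i K hi ih => rw [Finset.sum_insert hi, Finset.prod_insert hi, hg.map_add, ih]

lemma integrable_comp (hg : IsCharacter g) {β : Type*} [MeasurableSpace β] {μ : Measure β}
    [IsFiniteMeasure μ] {f : β → PointMeasure} (hf : Measurable f) :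
    Integrable (fun b => g (f b)) μ :=
  .of_bound (hg.measurable.comp hf).aestronglyMeasurable 1 (.of_forall fun _ => hg.norm_le _)

end IsCharacter

/-- The masses of all the measurable sets. -/
def masses (s : PointMeasure) : {B : Set PosReal // MeasurableSet B} → ℝ :=
  fun B => (s : Measure PosReal).real B

lemma measurable_masses : Measurable masses :=
  measurable_pi_iff.2 fun B => (measurable_coe_apply B.2).ennreal_toReal

/-- All masses are finite, so passing to real values loses nothing, and the laws of point measures
may be compared through a product of real lines. -/
lemma comap_masses : MeasurableSpace.comap masses inferInstance =
    (inferInstance : MeasurableSpace PointMeasure) := by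
  refine le_antisymm measurable_masses.comap_le ?_
  have h : @Measurable PointMeasure PointMeasure (MeasurableSpace.comap masses inferInstance) _
      id := by
    refine @measurable_pointMeasure PointMeasure (MeasurableSpace.comap masses inferInstance) id
      fun B hB => ?_
    have h1 : @Measurable _ ({B : Set PosReal // MeasurableSet B} → ℝ)
        (MeasurableSpace.comap masses inferInstance) _ masses := comap_measurable masses
    have h2 : (fun s : PointMeasure => (s : Measure PosReal) B) =
        fun s => ENNReal.ofReal (masses s ⟨B, hB⟩) := by
      funext s
      simp [masses]
    change @Measurable _ _ (MeasurableSpace.comap masses inferInstance) _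
      (fun s : PointMeasure => (s : Measure PosReal) B)
    rw [h2]
    exact ENNReal.measurable_ofReal.comp
      ((measurable_pi_apply (⟨B, hB⟩ : {B : Set PosReal // MeasurableSet B})).comp h1)
  intro S hS
  exact h hS

lemma masses_add (s s' : PointMeasure) : masses (s + s') = masses s + masses s' := by
  funext B
  simp only [masses, AddSubmonoid.coe_add, Pi.add_apply]
  exact measureReal_add_apply

/-- Finite measures on the space of point measures are determined by characters. -/
lemma ext_of_character {μ μ' : Measure PointMeasure} [IsFiniteMeasure μ] [IsFiniteMeasure μ']
    (h : ∀ g, IsCharacter g → ∫ s, g s ∂μ = ∫ s, g s ∂μ') : μ = μ' := by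
  have hJ : ∀ J : Finset {B : Set PosReal // MeasurableSet B},
      (μ.map masses).map J.restrict = (μ'.map masses).map J.restrict := by
    intro J
    have hm : Measurable (J.restrict (π := fun _ => ℝ)) := by fun_prop
    refine Measure.ext_of_charFunDual (funext fun L => ?_)
    have hL : Measurable fun v : J → ℝ => Complex.exp (L v * Complex.I) := by
      have := L.continuous
      fun_prop
    -- Masses are additive in `s`, so the exponentials in the characteristic functions of the
    -- finite-dimensional marginals are characters.
    have hg : IsCharacter fun s => Complex.exp (L (J.restrict (masses s)) * Complex.I) :=
      { measurable := hL.comp (hm.comp measurable_masses)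
        norm_le := fun s => (Complex.norm_exp_ofReal_mul_I _).le
        map_zero := by
          have : masses 0 = 0 := by funext B; simp [masses]
          rw [this]
          have : J.restrict (π := fun _ => ℝ) 0 = 0 := rfl
          simp [this]
        map_add := fun s s' => by
          have : J.restrict (masses (s + s')) = J.restrict (masses s) + J.restrict (masses s') := by
            rw [masses_add]; rfl
          rw [this, _root_.map_add, Complex.ofReal_add, add_mul, Complex.exp_add] }
    have key : ∀ ρ : Measure PointMeasure, charFunDual ((ρ.map masses).map J.restrict) L =
        ∫ s, Complex.exp (L (J.restrict (masses s)) * Complex.I) ∂ρ := fun ρ => by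
      rw [charFunDual_apply, Measure.map_map hm measurable_masses,
        integral_map (hm.comp measurable_masses).aemeasurable hL.aestronglyMeasurable]
      rfl
    rw [key, key, h _ hg]
  have hmap : μ.map masses = μ'.map masses :=
    IsProjectiveLimit.unique (P := fun J => (μ.map masses).map J.restrict) (fun _ => rfl)
      fun J => (hJ J).symm
  ext S hS
  obtain ⟨T, hT, rfl⟩ : ∃ T, MeasurableSet T ∧ masses ⁻¹' T = S := by
    have := comap_masses.symm.le S hS
    exact this
  rw [← Measure.map_apply measurable_masses hT, hmap, Measure.map_apply measurable_masses hT]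

/-! ### A measurable enumeration of the atoms -/

/-- The atoms of a point measure in increasing order. -/
def sortedAtoms (s : PointMeasure) : List PosReal :=
  (exists_eq_sum_atom s).choose.insertionSort (· ≤ ·)

lemma sum_sortedAtoms (s : PointMeasure) : ((sortedAtoms s).map atom).sum = s := by
  conv_rhs => rw [(exists_eq_sum_atom s).choose_spec]
  exact ((List.perm_insertionSort _ _).map atom).sum_eq

lemma pairwise_sortedAtoms (s : PointMeasure) : (sortedAtoms s).Pairwise (· ≤ ·) :=
  List.pairwise_insertionSort _ _

open Classical in
lemma sum_atom_apply (l : List PosReal) {B : Set PosReal} (hB : MeasurableSet B) :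
    (((l.map atom).sum : PointMeasure) : Measure PosReal) B = l.countP (· ∈ B) := by
  induction l with
  | nil => simp
  | cons a l ih =>
    rw [List.map_cons, List.sum_cons, AddSubmonoid.coe_add, Measure.add_apply, ih, coe_atom,
      Measure.dirac_apply' _ hB, List.countP_cons]
    by_cases h : a ∈ B <;> simp [h, add_comm]

open Classical in
lemma coe_apply_eq_countP (s : PointMeasure) {B : Set PosReal} (hB : MeasurableSet B) :
    (s : Measure PosReal) B = (sortedAtoms s).countP (· ∈ B) := by
  conv_lhs => rw [← sum_sortedAtoms s]
  exact sum_atom_apply _ hB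

lemma coe_univ_eq_length (s : PointMeasure) :
    (s : Measure PosReal) Set.univ = (sortedAtoms s).length := by
  classical
  rw [coe_apply_eq_countP s .univ]
  simp

/-- The masses of singletons give the multiplicities. -/
lemma perm_of_sum_atom_eq {l l' : List PosReal} (h : (l.map atom).sum = (l'.map atom).sum) :
    l.Perm l' := by
  classical
  rw [List.perm_iff_count]
  intro a
  have h1 : ∀ l : List PosReal,
      (((l.map atom).sum : PointMeasure) : Measure PosReal) {a} = l.count a := fun l => by
    rw [sum_atom_apply l (measurableSet_singleton a), List.count]
    congr 2
    funext b
    simp [Bool.beq_eq_decide_eq]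
  have h2 := h1 l
  rw [h, h1 l'] at h2
  exact_mod_cast h2.symm

lemma getElem_le_iff_lt_countP {β : Type*} [LinearOrder β] {l : List β} (hl : l.Pairwise (· ≤ ·))
    (x : β) {i : ℕ} (hi : i < l.length) : l[i] ≤ x ↔ i < l.countP (· ≤ x) := by
  induction l generalizing i with
  | nil => simp at hi
  | cons a l ih =>
    rw [List.pairwise_cons] at hl
    by_cases hax : a ≤ x
    · cases i with
      | zero => simp [hax]
      | succ i =>
        have := ih hl.2 (by simpa using hi)
        simp [hax, this]
    · have h0 : l.countP (· ≤ x) = 0 := by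
        rw [List.countP_eq_zero]
        intro b hb
        simpa using (not_le.1 hax).trans_le (hl.1 b hb)
      cases i with
      | zero => simp [hax, h0]
      | succ i =>
        have hi' : i < l.length := by simpa using hi
        have := hl.1 l[i] (List.getElem_mem hi')
        simpa [hax, h0] using (not_le.1 hax).trans_le this

/-- The `i`-th atom of a point measure, in increasing order. -/
def nthAtom (s : PointMeasure) (i : ℕ) : PosReal := (sortedAtoms s).getD i 1

lemma measurable_length_sortedAtoms : Measurable fun s => (sortedAtoms s).length := by
  have h : Measurable fun s : PointMeasure => ⌊((s : Measure PosReal) Set.univ).toReal⌋₊ :=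
    (measurable_coe_apply .univ).ennreal_toReal.nat_floor
  have : (fun s => (sortedAtoms s).length) =
      fun s : PointMeasure => ⌊((s : Measure PosReal) Set.univ).toReal⌋₊ := by
    funext s
    rw [coe_univ_eq_length]
    simp
  rwa [this]

lemma measurable_nthAtom (i : ℕ) : Measurable fun s => nthAtom s i := by
  classical
  suffices h : Measurable fun s => (nthAtom s i : ℝ) from h.subtype_mk
  refine measurable_of_Iic fun x => ?_
  have hB : MeasurableSet {y : PosReal | (y : ℝ) ≤ x} :=
    measurableSet_le measurable_subtype_coe measurable_const
  have h1 : MeasurableSet {s : PointMeasure | (i : ℝ≥0∞) < (s : Measure PosReal) {y | (y : ℝ) ≤ x}} :=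
    measurableSet_lt measurable_const (measurable_coe_apply hB)
  have h2 : MeasurableSet {s : PointMeasure | (sortedAtoms s).length ≤ i} :=
    measurable_length_sortedAtoms measurableSet_Iic
  -- The `i`-th atom is at most `x` iff more than `i` atoms are, counting from 0. The second set
  -- accounts for the default value 1 when there are too few atoms.
  have : (fun s => (nthAtom s i : ℝ)) ⁻¹' Set.Iic x =
      {s : PointMeasure | (i : ℝ≥0∞) < (s : Measure PosReal) {y | (y : ℝ) ≤ x}} ∪
        ({s : PointMeasure | (sortedAtoms s).length ≤ i} ∩ {_s | (1 : ℝ) ≤ x}) := by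
    ext s
    simp only [Set.mem_preimage, Set.mem_Iic, Set.mem_union, Set.mem_inter_iff, Set.mem_ofPred_eq]
    rw [coe_apply_eq_countP s hB, Nat.cast_lt, nthAtom]
    by_cases hi : i < (sortedAtoms s).length
    · rw [List.getD_eq_getElem _ _ hi]
      simp only [not_le.2 hi, false_and, or_false, Set.mem_ofPred_eq]
      rcases lt_or_ge 0 x with hx | hx
      · exact getElem_le_iff_lt_countP (pairwise_sortedAtoms s) (⟨x, hx⟩ : PosReal) hi
      · have h0 : ∀ y : PosReal, ¬ (y : ℝ) ≤ x := fun y => not_le.2 (hx.trans_lt y.2)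
        simp [h0]
    · rw [List.getD_eq_default _ _ (not_lt.1 hi)]
      have h3 : (sortedAtoms s).countP (· ∈ {y : PosReal | (y : ℝ) ≤ x}) ≤ i :=
        List.countP_le_length.trans (not_lt.1 hi)
      simp only [not_lt.2 h3, not_lt.1 hi, true_and, false_or]
      rfl
  rw [this]
  exact h1.union (h2.inter (.const _))

/-! ### The transition kernels -/

/-- The sum of the processes started from the atoms of `p.1`, with the noises `p.2`. -/
def sumTreeX (α t : ℝ) (p : PointMeasure × (ℕ → Noise)) : PointMeasure :=
  ∑ i ∈ Finset.range (sortedAtoms p.1).length, treeX α t (nthAtom p.1 i) (p.2 i)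

lemma measurable_sumTreeX (α t : ℝ) : Measurable (sumTreeX α t) := by
  refine measurable_pointMeasure fun B hB => ?_
  have h : ∀ p, (sumTreeX α t p : Measure PosReal) B = ∑' i, if i < (sortedAtoms p.1).length then
      (treeX α t (nthAtom p.1 i) (p.2 i) : Measure PosReal) B else 0 := fun p => by
    rw [sumTreeX, AddSubmonoid.coe_finsetSum, Measure.finsetSum_apply,
      tsum_eq_sum (s := Finset.range (sortedAtoms p.1).length)]
    · exact Finset.sum_congr rfl fun i hi => (if_pos (Finset.mem_range.1 hi)).symm
    · intro i hi
      exact if_neg (by simpa using hi)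
  simp_rw [h]
  refine Measurable.tsum fun i => Measurable.ite ?_ ?_ measurable_const
  · exact measurableSet_lt measurable_const (measurable_length_sortedAtoms.comp measurable_fst)
  · have h1 : Measurable fun p : PointMeasure × (ℕ → Noise) =>
        (((nthAtom p.1 i : PosReal) : ℝ), p.2 i) :=
      (measurable_subtype_coe.comp ((measurable_nthAtom i).comp measurable_fst)).prodMk
        ((measurable_pi_apply i).comp measurable_snd)
    have h2 : Measurable fun p : PointMeasure × (ℕ → Noise) =>
        treeX α t (nthAtom p.1 i) (p.2 i) :=
      Measurable.comp (g := fun q : ℝ × Noise => treeX α t q.1 q.2)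
        (f := fun p : PointMeasure × (ℕ → Noise) => (((nthAtom p.1 i : PosReal) : ℝ), p.2 i))
        (measurable_treeX α t) h1
    exact Measurable.comp (g := fun s : PointMeasure => (s : Measure PosReal) B)
      (measurable_coe_apply hB) h2

variable (mY : Measure (ℕ → ℝ)) [IsProbabilityMeasure mY]

/-- The transition kernel of the process. -/
def transition (α t : ℝ) : Kernel PointMeasure PointMeasure where
  toFun s := ((Measure.infinitePi fun _ : ℕ => treeLaw mY).map (Prod.mk s)).map (sumTreeX α t)
  measurable' := (Measure.measurable_map _ (measurable_sumTreeX α t)).comp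
    Measurable.map_prodMk_left

instance (α t : ℝ) : IsMarkovKernel (transition mY α t) := ⟨fun s => by
  have := Measure.isProbabilityMeasure_map (μ := Measure.infinitePi fun _ : ℕ => treeLaw mY)
    (f := Prod.mk s) measurable_prodMk_left.aemeasurable
  exact Measure.isProbabilityMeasure_map (measurable_sumTreeX α t).aemeasurable⟩

/-- The mean of a character at time `t`, when the process starts from `x`. -/
def charMean (g : PointMeasure → ℂ) (α t x : ℝ) : ℂ := ∫ W, g (treeX α t x W) ∂treeLaw mY

variable {mY} {g : PointMeasure → ℂ}

lemma integral_transition (hg : IsCharacter g) (α t : ℝ) (s : PointMeasure) :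
    ∫ s', g s' ∂transition mY α t s =
      ((sortedAtoms s).map fun x : PosReal => charMean mY g α t x).prod := by
  have h1 : ∫ s', g s' ∂transition mY α t s =
      ∫ V, g (sumTreeX α t (s, V)) ∂Measure.infinitePi fun _ : ℕ => treeLaw mY := by
    change ∫ s', g s' ∂((Measure.infinitePi fun _ : ℕ => treeLaw mY).map (Prod.mk s)).map _ = _
    rw [Measure.map_map (measurable_sumTreeX α t) measurable_prodMk_left, integral_map
      ((measurable_sumTreeX α t).comp measurable_prodMk_left).aemeasurable
      hg.measurable.aestronglyMeasurable]
    rfl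
  have hind : iIndepFun (fun (i : Fin (sortedAtoms s).length) (V : ℕ → Noise) => V i)
      (Measure.infinitePi fun _ : ℕ => treeLaw mY) :=
    (iIndepFun_infinitePi (P := fun _ : ℕ => treeLaw mY) (X := fun _ W => W)
      fun _ => measurable_id).precomp Fin.val_injective
  have hmeas : ∀ x : ℝ, Measurable fun W => g (treeX α t x W) := fun x =>
    hg.measurable.comp (measurable_treeX_right α t x)
  rw [h1]
  simp only [sumTreeX, hg.map_sum, Finset.prod_range]
  rw [hind.integral_fun_prod_comp
    (f := fun (i : Fin (sortedAtoms s).length) W => g (treeX α t (nthAtom s i) W))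
    (fun i => (measurable_pi_apply (i : ℕ)).aemeasurable)
    (fun i => (hmeas _).aestronglyMeasurable), ← Fin.prod_univ_fun_getElem]
  refine Finset.prod_congr rfl fun i _ => ?_
  have hmp := measurePreserving_eval_infinitePi (fun _ : ℕ => treeLaw mY) (i : ℕ)
  have h2 := integral_map (μ := Measure.infinitePi fun _ : ℕ => treeLaw mY)
    hmp.measurable.aemeasurable (hmeas (nthAtom s i)).aestronglyMeasurable
  rw [hmp.map_eq] at h2
  rw [← List.getD_eq_getElem _ 1 i.2]
  exact h2.symm

/-- The product does not depend on the order of the factors, so the increasing enumeration used to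
define the kernel leaves no trace. -/
lemma integral_transition_sum (hg : IsCharacter g) (α t : ℝ) {ι : Type*} (K : Finset ι)
    (z : ι → PosReal) : ∫ s', g s' ∂transition mY α t (∑ i ∈ K, atom (z i)) =
      ∏ i ∈ K, charMean mY g α t (z i) := by
  have h : (sortedAtoms (∑ i ∈ K, atom (z i))).Perm (K.toList.map z) := by
    refine perm_of_sum_atom_eq ?_
    rw [sum_sortedAtoms, List.map_map, ← Finset.sum_map_toList]
    rfl
  rw [integral_transition hg, (h.map _).prod_eq, List.map_map, ← Finset.prod_map_toList]
  rfl

lemma transition_sum_atom (α t : ℝ) {n : ℕ} (z : Fin n → PosReal) :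
    transition mY α t (∑ i, atom (z i)) =
      (Measure.pi fun i => (treeLaw mY).map fun W => treeX α t (z i) W).map
        fun y : Fin n → PointMeasure => ∑ i, y i := by
  have hX : ∀ i, Measurable fun W => treeX α t (z i) W := fun i => measurable_treeX_right α t (z i)
  have hprob : ∀ i, IsProbabilityMeasure ((treeLaw mY).map fun W => treeX α t (z i) W) := fun i =>
    Measure.isProbabilityMeasure_map (hX i).aemeasurable
  have hsum : Measurable fun y : Fin n → PointMeasure => ∑ i, y i :=
    measurable_pointMeasure fun B hB => by
      simp only [AddSubmonoid.coe_finsetSum, Measure.finsetSum_apply]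
      exact Finset.measurable_sum _ fun i _ => (measurable_coe_apply hB).comp (measurable_pi_apply i)
  refine ext_of_character fun g hg => ?_
  rw [integral_transition_sum hg, integral_map hsum.aemeasurable
    hg.measurable.aestronglyMeasurable]
  simp only [hg.map_sum]
  rw [integral_fintype_prod_eq_prod (𝕜 := ℂ) (fun _ => g)]
  refine Finset.prod_congr rfl fun i _ => ?_
  rw [integral_map (hX i).aemeasurable hg.measurable.aestronglyMeasurable, charMean]

end

section

/-! ### Lack of memory -/

/-- Lack of memory: `exp (-(e + θ)) = exp (-θ) * exp (-e)`, and Lebesgue measure is translation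
invariant. -/
lemma map_sub_restrict_expMeasure {θ : ℝ} (hθ : 0 ≤ θ) :
    ((expMeasure 1).restrict (Set.Ioi θ)).map (fun e => e - θ) =
      ENNReal.ofReal (Real.exp (-θ)) • expMeasure 1 := by
  have hm : Measurable fun e : ℝ => ENNReal.ofReal (Real.exp (-e)) := by fun_prop
  have h : ∀ A : Set ℝ, MeasurableSet A → expMeasure 1 A =
      ∫⁻ e, (Set.Ioi 0 ∩ A).indicator (fun e => ENNReal.ofReal (Real.exp (-e))) e := fun A hA => by
    rw [expMeasure_one_eq, withDensity_apply _ hA, Measure.restrict_restrict hA,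
      lintegral_indicator (measurableSet_Ioi.inter hA), Set.inter_comm]
  ext B hB
  have hB' : MeasurableSet ((fun e : ℝ => e - θ) ⁻¹' B) := (measurable_sub_const θ) hB
  rw [Measure.map_apply (measurable_sub_const θ) hB, Measure.restrict_apply hB',
    h _ (hB'.inter measurableSet_Ioi), Measure.smul_apply, smul_eq_mul, h B hB,
    ← lintegral_const_mul _ (hm.indicator (measurableSet_Ioi.inter hB)),
    ← lintegral_add_right_eq_self _ θ]
  refine lintegral_congr fun e => ?_
  by_cases he : e ∈ Set.Ioi 0 ∩ B
  · rw [Set.indicator_of_mem he, Set.indicator_of_mem, ← ENNReal.ofReal_mul (Real.exp_pos _).le,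
      ← Real.exp_add]
    · ring_nf
    · have := he.1
      simp only [Set.mem_Ioi] at this
      exact ⟨by simp only [Set.mem_Ioi]; linarith, by simpa using he.2, by simpa using this⟩
  · rw [Set.indicator_of_notMem he, Set.indicator_of_notMem, mul_zero]
    rintro ⟨-, h1, h2⟩
    exact he ⟨by simpa using h2, by simpa using h1⟩

variable {mY : Measure (ℕ → ℝ)} [IsProbabilityMeasure mY]

lemma measurable_shiftClock : Measurable fun p : ℝ × Noise => shiftClock p.1 p.2 := by
  refine measurable_pi_iff.2 fun v => ?_
  by_cases h : v = []
  · subst h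
    simp only [shiftClock, Function.update_self]
    fun_prop
  · simp only [shiftClock, Function.update_of_ne h]
    fun_prop

lemma measurable_shiftClock_right (θ : ℝ) : Measurable (shiftClock θ) :=
  Measurable.comp (g := fun p : ℝ × Noise => shiftClock p.1 p.2) (f := fun V : Noise => (θ, V))
    measurable_shiftClock measurable_prodMk_left

lemma measurableSet_lt_clock (θ : ℝ) : MeasurableSet {V : Noise | θ < clocks V []} :=
  measurableSet_lt measurable_const (measurable_snd.comp (measurable_pi_apply []))

lemma shiftClock_join (θ : ℝ) (a : Mark) (V : ℕ → Noise) :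
    shiftClock θ (join (a, V)) = join ((a.1, a.2 - θ), V) := by
  funext v
  rcases List.eq_nil_or_concat' v with rfl | ⟨w, i, rfl⟩
  · simp [shiftClock]
  · simp [shiftClock]

/-- Both the event and the shift concern the clock of the root alone, one factor of the product
obtained from `join`. -/
lemma map_shiftClock_restrict {θ : ℝ} (hθ : 0 ≤ θ) :
    ((treeLaw mY).restrict {V | θ < clocks V []}).map (shiftClock θ) =
      ENNReal.ofReal (Real.exp (-θ)) • treeLaw mY := by
  set ρ := Measure.infinitePi fun _ : ℕ => treeLaw mY
  have hj : treeLaw mY = ((mY.prod (expMeasure 1)).prod ρ).map join := (map_join _).symm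
  have hpre : join ⁻¹' {V | θ < clocks V []} = (Set.univ ×ˢ Set.Ioi θ) ×ˢ Set.univ := by
    ext p
    simp [clocks]
  have hcomp : shiftClock θ ∘ join =
      join ∘ Prod.map (Prod.map id (fun e : ℝ => e - θ)) (id : (ℕ → Noise) → _) := by
    funext p
    exact shiftClock_join θ p.1 p.2
  have hms : Measurable (Prod.map (id : (ℕ → ℝ) → _) (fun e : ℝ => e - θ)) :=
    measurable_id.prodMap (measurable_sub_const θ)
  conv_lhs => rw [hj]
  rw [Measure.restrict_map measurable_join (measurableSet_lt_clock θ), hpre,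
    Measure.map_map (measurable_shiftClock_right θ) measurable_join, hcomp,
    ← Measure.map_map measurable_join (hms.prodMap measurable_id), ← Measure.prod_restrict,
    ← Measure.prod_restrict, Measure.restrict_univ, Measure.restrict_univ,
    ← Measure.map_prod_map _ _ hms measurable_id,
    ← Measure.map_prod_map _ _ measurable_id (measurable_sub_const θ), Measure.map_id,
    Measure.map_id, map_sub_restrict_expMeasure hθ, Measure.prod_smul_right,
    Measure.prod_smul_left, Measure.map_smul, ← hj]

lemma integral_shiftClock {θ : ℝ} (hθ : 0 ≤ θ) {h : Noise → ℂ} (hm : Measurable h) :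
    ∫ V, {V | θ < clocks V []}.indicator (fun V => h (shiftClock θ V)) V ∂treeLaw mY =
      Real.exp (-θ) * ∫ V, h V ∂treeLaw mY := by
  rw [integral_indicator (measurableSet_lt_clock θ),
    ← integral_map (measurable_shiftClock_right θ).aemeasurable hm.aestronglyMeasurable,
    map_shiftClock_restrict hθ, integral_smul_measure, ENNReal.toReal_ofReal (Real.exp_pos _).le,
    Complex.real_smul]

/-! ### Resampling the subtree of one node -/

section OneNode

variable {α x r : ℝ} {u : Node}

lemma measurable_threshold (α x r : ℝ) (u : Node) : Measurable fun W => threshold α x r W u := by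
  have h : Measurable fun W : Noise => ((x, W) : ℝ × Noise) := measurable_prodMk_left
  have h1 : Measurable fun W : Noise => size x (ratios W) u := (measurable_size u).comp h
  have h2 : Measurable fun W : Noise => birth α x (ratios W) (clocks W) u :=
    (measurable_birth α u).comp h
  exact (measurable_const.sub h2).mul (h1.pow_const α)

lemma measurable_freeze (α x r : ℝ) (u : Node) : Measurable (freeze α x r u) := by
  have h : Measurable fun W : Noise =>
      (W, fun _ : Node => ((0, threshold α x r W u + 1) : Mark)) :=
    measurable_id.prodMk (measurable_pi_iff.2 fun _ =>
      measurable_const.prodMk ((measurable_threshold α x r u).add_const 1))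
  exact (measurable_graft u).comp h

lemma measurable_residual (α x r : ℝ) (u : Node) : Measurable fun W => residual α x r W u := by
  have h : Measurable (subtree u) := measurable_pi_iff.2 fun v => measurable_pi_apply (v ++ u)
  exact Measurable.comp (g := fun p : ℝ × Noise => shiftClock p.1 p.2)
    (f := fun W => (threshold α x r W u, subtree u W)) measurable_shiftClock
    ((measurable_threshold α x r u).prodMk h)

lemma measurableSet_alive_right (α x r : ℝ) (u : Node) :
    MeasurableSet {W : Noise | Alive α x (ratios W) (clocks W) r u} :=
  measurable_prodMk_left (measurableSet_alive α r u)

lemma measurable_size_right (x : ℝ) (u : Node) : Measurable fun W : Noise => size x (ratios W) u :=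
  Measurable.comp (g := fun p : ℝ × Noise => size p.1 (ratios p.2) u)
    (f := fun W : Noise => (x, W)) (measurable_size u) measurable_prodMk_left

lemma integral_graft {f : Noise → ℂ} (hf : Integrable f (treeLaw mY)) (u : Node) :
    ∫ W, f W ∂treeLaw mY = ∫ W, ∫ V, f (graft u W V) ∂treeLaw mY ∂treeLaw mY := by
  have hmap := map_graft (mY.prod (expMeasure 1)) u
  have hf' : Integrable f (((treeLaw mY).prod (treeLaw mY)).map fun p => graft u p.1 p.2) := by
    rwa [hmap]
  have h1 := hf'.comp_measurable (measurable_graft u)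
  have h2 := integral_prod _ h1
  simp only [Function.comp_apply] at h2
  rw [← h2, ← integral_map (measurable_graft u).aemeasurable hf'.aestronglyMeasurable, hmap]

/-- The subtree of `u` is resampled by an independent `V`. Given `W`, the integrand sees `V` only
through the event that its root clock exceeds the threshold and through the shifted noise, so lack
of memory makes the residual tree a fresh one. -/
lemma integral_alive_eq (hgood : ∀ᵐ W ∂treeLaw mY, IsGood W) {Z : Noise → ℂ} (hZ : Measurable Z)
    (hZ1 : ∀ W, ‖Z W‖ ≤ 1) (hinv : ∀ W, IsGood W → Alive α x (ratios W) (clocks W) r u →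
      Z (freeze α x r u W) = Z W)
    {h : ℝ × Noise → ℂ} (hh : Measurable h) (hh1 : ∀ p, ‖h p‖ ≤ 1) :
    ∫ W, {W : Noise | Alive α x (ratios W) (clocks W) r u}.indicator
        (fun W => Z W * h (size x (ratios W) u, residual α x r W u)) W ∂treeLaw mY =
      ∫ W, {W : Noise | 0 < size x (ratios W) u ∧
          birth α x (ratios W) (clocks W) u ≤ r}.indicator
        (fun W => Z (freeze α x r u W) * (Real.exp (-threshold α x r W u) *
          ∫ V, h (size x (ratios W) u, V) ∂treeLaw mY)) W ∂treeLaw mY := by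
  classical
  set A := {W : Noise | Alive α x (ratios W) (clocks W) r u} with hA
  -- `Z` is replaced by its value at the frozen noise, the same almost surely on `A`, but unaffected
  -- by the graft at `u`.
  set f : Noise → ℂ := A.indicator fun W =>
    Z (freeze α x r u W) * h (size x (ratios W) u, residual α x r W u) with hf
  have hhm : Measurable fun W : Noise => h (size x (ratios W) u, residual α x r W u) :=
    hh.comp ((measurable_size_right x u).prodMk (measurable_residual α x r u))
  have hfm : Measurable f := ((hZ.comp (measurable_freeze α x r u)).mul hhm).indicator
    (measurableSet_alive_right α x r u)
  have hfint : Integrable f (treeLaw mY) := by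
    refine .of_bound hfm.aestronglyMeasurable 1 (.of_forall fun W => ?_)
    refine (norm_indicator_le_norm_self _ W).trans ?_
    rw [norm_mul]
    exact mul_le_one₀ (hZ1 _) (norm_nonneg _) (hh1 _)
  have h1 : ∫ W, A.indicator (fun W => Z W * h (size x (ratios W) u, residual α x r W u)) W
      ∂treeLaw mY = ∫ W, f W ∂treeLaw mY := by
    refine integral_congr_ae ?_
    filter_upwards [hgood] with W hW
    by_cases hWA : W ∈ A
    · rw [Set.indicator_of_mem hWA, hf, Set.indicator_of_mem hWA, hinv W hW hWA]
    · rw [Set.indicator_of_notMem hWA, hf, Set.indicator_of_notMem hWA]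
  rw [h1, integral_graft hfint u]
  refine integral_congr_ae (.of_forall fun W => ?_)
  beta_reduce
  have hclock : ∀ V : Noise, clocks (graft u W V) u = clocks V [] := fun V => by
    have := graft_append u W V []
    simp only [List.nil_append] at this
    simp only [clocks, this]
  by_cases hW : 0 < size x (ratios W) u ∧ birth α x (ratios W) (clocks W) u ≤ r
  · have hhW : Measurable fun V => h (size x (ratios W) u, V) := hh.comp measurable_prodMk_left
    rw [Set.indicator_of_mem (by exact hW),
      ← integral_shiftClock (threshold_nonneg hW.1 hW.2) hhW, ← integral_const_mul]
    refine integral_congr_ae (.of_forall fun V => ?_)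
    beta_reduce
    have hiff : graft u W V ∈ A ↔ V ∈ {V | threshold α x r W u < clocks V []} := by
      rw [hA, Set.mem_ofPred_eq, alive_iff, size_graft fun _ => rfl, birth_graft fun _ => rfl,
        threshold_graft fun _ => rfl, hclock]
      exact and_iff_right hW
    by_cases hV : V ∈ {V | threshold α x r W u < clocks V []}
    · rw [hf, Set.indicator_of_mem (hiff.2 hV), Set.indicator_of_mem hV, freeze_graft,
        size_graft fun _ => rfl, residual_graft]
    · rw [hf, Set.indicator_of_notMem fun h => hV (hiff.1 h), Set.indicator_of_notMem hV, mul_zero]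
  · rw [Set.indicator_of_notMem (by exact hW)]
    have : ∀ V, f (graft u W V) = 0 := fun V => by
      refine Set.indicator_of_notMem (fun h => hW ?_) _
      have := (alive_iff.1 h).1
      rwa [size_graft fun _ => rfl, birth_graft fun _ => rfl] at this
    simp [this]

end OneNode

end

section

/-! ### The branching property at a fixed time -/

variable {mY : Measure (ℕ → ℝ)} {g : PointMeasure → ℂ}

open Classical in
/-- The value of the character `g` at the population which descends, after time `t`, from the node
`u` alive at time `r`; and `1` if `u` is not alive. -/
def charFactor (g : PointMeasure → ℂ) (α x r t : ℝ) (u : Node) (W : Noise) : ℂ :=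
  if Alive α x (ratios W) (clocks W) r u then
    g (treeX α t (size x (ratios W) u) (residual α x r W u)) else 1

variable (mY) in
open Classical in
/-- The mean of `charFactor` given the size of the node. -/
def meanFactor (g : PointMeasure → ℂ) (α x r t : ℝ) (u : Node) (W : Noise) : ℂ :=
  if Alive α x (ratios W) (clocks W) r u then charMean mY g α t (size x (ratios W) u) else 1

lemma charFactor_freeze {α x r t : ℝ} {W : Noise} (hW : IsGood W) (hx : 0 ≤ x) {u v : Node}
    (hu : Alive α x (ratios W) (clocks W) r u) (hne : u ≠ v) :
    charFactor g α x r t v (freeze α x r u W) = charFactor g α x r t v W := by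
  unfold charFactor
  by_cases hv : Alive α x (ratios W) (clocks W) r v
  · rw [if_pos hv, if_pos ((alive_freeze hW hx hu le_rfl v).2 hv),
      size_freeze_of_alive hW hx hu le_rfl hv, residual_freeze hW hx hu hv hne]
  · rw [if_neg hv, if_neg fun h => hv ((alive_freeze hW hx hu le_rfl v).1 h)]

/-- In contrast with `charFactor_freeze`, the case `v = u` is included: the mean involves only the
size of `v` and whether it is alive. -/
lemma meanFactor_freeze {α x r t : ℝ} {W : Noise} (hW : IsGood W) (hx : 0 ≤ x) {u v : Node}
    (hu : Alive α x (ratios W) (clocks W) r u) :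
    meanFactor mY g α x r t v (freeze α x r u W) = meanFactor mY g α x r t v W := by
  unfold meanFactor
  by_cases hv : Alive α x (ratios W) (clocks W) r v
  · rw [if_pos hv, if_pos ((alive_freeze hW hx hu le_rfl v).2 hv),
      size_freeze_of_alive hW hx hu le_rfl hv]
  · rw [if_neg hv, if_neg fun h => hv ((alive_freeze hW hx hu le_rfl v).1 h)]

variable [IsProbabilityMeasure mY]

lemma measurable_character_treeX (hg : IsCharacter g) (α t : ℝ) :
    Measurable fun p : ℝ × Noise => g (treeX α t p.1 p.2) :=
  hg.measurable.comp (measurable_treeX α t)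

lemma measurable_charMean (hg : IsCharacter g) (α t : ℝ) :
    Measurable fun x => charMean mY g α t x :=
  ((measurable_character_treeX hg α t).stronglyMeasurable.integral_prod_right
    (ν := treeLaw mY)).measurable

lemma norm_charMean_le (hg : IsCharacter g) (α t x : ℝ) : ‖charMean mY g α t x‖ ≤ 1 := by
  have := norm_integral_le_of_norm_le_const (μ := treeLaw mY) (f := fun W => g (treeX α t x W))
    (.of_forall fun W => hg.norm_le _)
  simpa [charMean] using this

lemma measurable_charFactor (hg : IsCharacter g) (α x r t : ℝ) (u : Node) :
    Measurable (charFactor g α x r t u) := by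
  classical
  refine Measurable.ite (measurableSet_alive_right α x r u) ?_ measurable_const
  exact Measurable.comp (g := fun p : ℝ × Noise => g (treeX α t p.1 p.2))
    (f := fun W => (size x (ratios W) u, residual α x r W u)) (measurable_character_treeX hg α t)
    ((measurable_size_right x u).prodMk (measurable_residual α x r u))

lemma measurable_meanFactor (hg : IsCharacter g) (α x r t : ℝ) (u : Node) :
    Measurable (meanFactor mY g α x r t u) := by
  classical
  exact Measurable.ite (measurableSet_alive_right α x r u)
    ((measurable_charMean hg α t).comp (measurable_size_right x u)) measurable_const

lemma norm_charFactor_le (hg : IsCharacter g) (α x r t : ℝ) (u : Node) (W : Noise) :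
    ‖charFactor g α x r t u W‖ ≤ 1 := by
  unfold charFactor
  split_ifs
  · exact hg.norm_le _
  · simp

lemma norm_meanFactor_le (hg : IsCharacter g) (α x r t : ℝ) (u : Node) (W : Noise) :
    ‖meanFactor mY g α x r t u W‖ ≤ 1 := by
  unfold meanFactor
  split_ifs
  · exact norm_charMean_le hg _ _ _
  · simp

lemma norm_prod_le_one {ι β : Type*} {f : ι → β → ℂ} (hf : ∀ i b, ‖f i b‖ ≤ 1) (K : Finset ι)
    (b : β) : ‖∏ i ∈ K, f i b‖ ≤ 1 := by
  rw [norm_prod]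
  exact Finset.prod_le_one (fun _ _ => norm_nonneg _) fun i _ => hf i b

/-- `integral_alive_eq` is applied to the character of the residual tree and to its mean, which
ignores that tree. Both have the same integral over a fresh tree; off the event that `u` is alive
both factors are 1. -/
lemma integral_mul_charFactor (hgood : ∀ᵐ W ∂treeLaw mY, IsGood W) (hg : IsCharacter g)
    {α x r t : ℝ} {u : Node} {Z : Noise → ℂ} (hZ : Measurable Z) (hZ1 : ∀ W, ‖Z W‖ ≤ 1)
    (hinv : ∀ W, IsGood W → Alive α x (ratios W) (clocks W) r u → Z (freeze α x r u W) = Z W) :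
    ∫ W, Z W * charFactor g α x r t u W ∂treeLaw mY =
      ∫ W, Z W * meanFactor mY g α x r t u W ∂treeLaw mY := by
  classical
  set A := {W : Noise | Alive α x (ratios W) (clocks W) r u} with hA
  have hAm : MeasurableSet A := measurableSet_alive_right α x r u
  set h₁ : ℝ × Noise → ℂ := fun p => g (treeX α t p.1 p.2) with hh₁
  set h₂ : ℝ × Noise → ℂ := fun p => charMean mY g α t p.1 with hh₂
  have hm₁ : Measurable h₁ := measurable_character_treeX hg α t
  have hm₂ : Measurable h₂ := (measurable_charMean hg α t).comp measurable_fst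
  have e₁ := integral_alive_eq hgood hZ hZ1 hinv hm₁ fun p => hg.norm_le _
  have e₂ := integral_alive_eq hgood hZ hZ1 hinv hm₂ fun p => norm_charMean_le hg _ _ _
  have hmean : ∀ y : ℝ, ∫ V, h₂ (y, V) ∂treeLaw mY = ∫ V, h₁ (y, V) ∂treeLaw mY := fun y => by
    simp [hh₁, hh₂, charMean]
  simp only [hmean] at e₂
  have e := e₁.trans e₂.symm
  have hbd : ∀ {a b : ℂ}, ‖a‖ ≤ 1 → ‖b‖ ≤ 1 → ‖a * b‖ ≤ 1 := fun ha hb => by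
    rw [norm_mul]; exact mul_le_one₀ ha (norm_nonneg _) hb
  have hint : Integrable (Aᶜ.indicator Z) (treeLaw mY) :=
    .of_bound (hZ.indicator hAm.compl).aestronglyMeasurable 1
      (.of_forall fun W => (norm_indicator_le_norm_self _ W).trans (hZ1 W))
  have hint₁ : Integrable (A.indicator fun W => Z W * h₁ (size x (ratios W) u, residual α x r W u))
      (treeLaw mY) := by
    refine .of_bound ((hZ.mul (hm₁.comp ((measurable_size_right x u).prodMk
      (measurable_residual α x r u)))).indicator hAm).aestronglyMeasurable 1 (.of_forall fun W => ?_)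
    exact (norm_indicator_le_norm_self _ W).trans (hbd (hZ1 W) (hg.norm_le _))
  have hint₂ : Integrable (A.indicator fun W => Z W * h₂ (size x (ratios W) u, residual α x r W u))
      (treeLaw mY) := by
    refine .of_bound ((hZ.mul (hm₂.comp ((measurable_size_right x u).prodMk
      (measurable_residual α x r u)))).indicator hAm).aestronglyMeasurable 1 (.of_forall fun W => ?_)
    exact (norm_indicator_le_norm_self _ W).trans (hbd (hZ1 W) (norm_charMean_le hg _ _ _))
  have d₁ : (fun W => Z W * charFactor g α x r t u W) = fun W =>
      A.indicator (fun W => Z W * h₁ (size x (ratios W) u, residual α x r W u)) W +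
        Aᶜ.indicator Z W := by
    funext W
    by_cases hW : W ∈ A
    · rw [Set.indicator_of_mem hW, Set.indicator_of_notMem (by simpa using hW), charFactor,
        if_pos (by exact hW), add_zero]
    · rw [Set.indicator_of_notMem hW, Set.indicator_of_mem (by exact hW), charFactor,
        if_neg (by exact hW), zero_add, mul_one]
  have d₂ : (fun W => Z W * meanFactor mY g α x r t u W) = fun W =>
      A.indicator (fun W => Z W * h₂ (size x (ratios W) u, residual α x r W u)) W +
        Aᶜ.indicator Z W := by
    funext W
    by_cases hW : W ∈ A
    · rw [Set.indicator_of_mem hW, Set.indicator_of_notMem (by simpa using hW), meanFactor,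
        if_pos (by exact hW), add_zero]
    · rw [Set.indicator_of_notMem hW, Set.indicator_of_mem (by exact hW), meanFactor,
        if_neg (by exact hW), zero_add, mul_one]
  rw [d₁, d₂, integral_add hint₁ hint, integral_add hint₂ hint, e]

/-- The factors are exchanged one at a time, with `Z` arbitrary: for the exchange at `u` the factors
of the other nodes are absorbed into `Z`, and afterwards the mean factor of `u` is. -/
lemma integral_mul_prod_charFactor (hgood : ∀ᵐ W ∂treeLaw mY, IsGood W) (hg : IsCharacter g)
    {α x r t : ℝ} (hx : 0 ≤ x) (K : Finset Node) :
    ∀ Z : Noise → ℂ, Measurable Z → (∀ W, ‖Z W‖ ≤ 1) →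
    (∀ u ∈ K, ∀ W, IsGood W → Alive α x (ratios W) (clocks W) r u →
      Z (freeze α x r u W) = Z W) →
    ∫ W, Z W * ∏ u ∈ K, charFactor g α x r t u W ∂treeLaw mY =
      ∫ W, Z W * ∏ u ∈ K, meanFactor mY g α x r t u W ∂treeLaw mY := by
  classical
  have hbd : ∀ {a b : ℂ}, ‖a‖ ≤ 1 → ‖b‖ ≤ 1 → ‖a * b‖ ≤ 1 := fun ha hb => by
    rw [norm_mul]; exact mul_le_one₀ ha (norm_nonneg _) hb
  induction K using Finset.induction_on with
  | empty => intro Z _ _ _; simp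
  | insert u K hu ih =>
    intro Z hZ hZ1 hinv
    have h1 := integral_mul_charFactor (Z := fun W => Z W * ∏ v ∈ K, charFactor g α x r t v W)
      hgood hg (α := α) (x := x) (r := r) (t := t) (u := u)
      (hZ.mul (Finset.measurable_fun_prod _ fun v _ => measurable_charFactor hg α x r t v))
      (fun W => hbd (hZ1 W) (norm_prod_le_one (norm_charFactor_le hg α x r t) K W))
      (fun W hW hA => by
        rw [hinv u (Finset.mem_insert_self u K) W hW hA]
        congr 1
        exact Finset.prod_congr rfl fun v hv => charFactor_freeze hW hx hA
          fun h => hu (h ▸ hv))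
    have h2 := ih (fun W => Z W * meanFactor mY g α x r t u W)
      (hZ.mul (measurable_meanFactor hg α x r t u))
      (fun W => hbd (hZ1 W) (norm_meanFactor_le hg α x r t u W))
      (fun v hv W hW hA => by
        rw [hinv v (Finset.mem_insert_of_mem hv) W hW hA, meanFactor_freeze hW hx hA])
    simp only [Finset.prod_insert hu]
    calc _ = ∫ W, Z W * (∏ v ∈ K, charFactor g α x r t v W) * charFactor g α x r t u W
          ∂treeLaw mY := integral_congr_ae (.of_forall fun W => by ring)
      _ = _ := h1
      _ = ∫ W, Z W * meanFactor mY g α x r t u W * ∏ v ∈ K, charFactor g α x r t v W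
          ∂treeLaw mY := integral_congr_ae (.of_forall fun W => by ring)
      _ = _ := h2
      _ = _ := integral_congr_ae (.of_forall fun W => by ring)

/-- The population of a residual tree is part of the population at time `t + r`, which is finite. -/
lemma pop_residual_mem {α x r t : ℝ} {W : Noise} (hW : IsGood W) (hx : 0 ≤ x) (hr : 0 ≤ r)
    (ht : 0 ≤ t) (hfin : (born α x W (t + r)).Finite) {u : Node}
    (hu : Alive α x (ratios W) (clocks W) r u) :
    pop α (size x (ratios W) u) t (residual α x r W u) ∈ pointMeasures := by
  classical
  rw [pop_eq_diracSum, diracSum_mem_iff, ← pop_eq_diracSum]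
  refine lt_of_le_of_lt ?_ (univ_lt_top ⟨_, pop_mem_pointMeasures (finite_alive hfin)⟩)
  change _ ≤ pop α x (t + r) W Set.univ
  rw [pop_add_apply hW hx hr ht .univ]
  refine le_trans ?_ (ENNReal.le_tsum u)
  rw [if_pos hu]

lemma treeX_add {α x r t : ℝ} {W : Noise} (hW : IsGood W) (hx : 0 ≤ x) (hr : 0 ≤ r)
    (ht : 0 ≤ t) (hfin : (born α x W (t + r)).Finite)
    (hA : {u | Alive α x (ratios W) (clocks W) r u}.Finite) :
    treeX α (t + r) x W =
      ∑ u ∈ hA.toFinset, treeX α t (size x (ratios W) u) (residual α x r W u) := by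
  classical
  refine Subtype.ext (Measure.ext fun B hB => ?_)
  rw [treeX, toPointMeasure_of_mem (pop_mem_pointMeasures (finite_alive hfin)),
    pop_add_apply hW hx hr ht hB, AddSubmonoid.coe_finsetSum, Measure.finsetSum_apply,
    tsum_eq_sum (s := hA.toFinset)]
  · refine Finset.sum_congr rfl fun u hu => ?_
    have hu' : Alive α x (ratios W) (clocks W) r u := by simpa using hu
    rw [if_pos hu', treeX, toPointMeasure_of_mem (pop_residual_mem hW hx hr ht hfin hu')]
  · intro u hu
    exact if_neg (by simpa using hu)

lemma prod_charFactor_eq (hg : IsCharacter g) {α x r t : ℝ} {W : Noise} (hW : IsGood W)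
    (hx : 0 ≤ x) (hr : 0 ≤ r) (ht : 0 ≤ t) (hfin : (born α x W (t + r)).Finite)
    (hA : {u | Alive α x (ratios W) (clocks W) r u}.Finite) {K : Finset Node}
    (hK : hA.toFinset ⊆ K) :
    ∏ u ∈ K, charFactor g α x r t u W = g (treeX α (t + r) x W) := by
  rw [treeX_add hW hx hr ht hfin hA, hg.map_sum, ← Finset.prod_subset hK (f := fun u =>
    charFactor g α x r t u W) fun u _ hu => if_neg (by simpa using hu)]
  exact Finset.prod_congr rfl fun u hu => if_pos (by simpa using hu)

lemma prod_meanFactor_eq (hg : IsCharacter g) {α x r t : ℝ} {W : Noise}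
    (hA : {u | Alive α x (ratios W) (clocks W) r u}.Finite) {K : Finset Node}
    (hK : hA.toFinset ⊆ K) :
    ∏ u ∈ K, meanFactor mY g α x r t u W = ∫ s, g s ∂transition mY α t (treeX α r x W) := by
  rw [treeX_eq_sum hA, integral_transition_sum hg, ← Finset.prod_subset hK (f := fun u =>
    meanFactor mY g α x r t u W) fun u _ hu => if_neg (by simpa using hu)]
  refine Finset.prod_congr rfl fun u hu => ?_
  have hu' : Alive α x (ratios W) (clocks W) r u := by simpa using hu
  rw [meanFactor, if_pos hu', toPos_of_pos hu'.1]

variable {ν : Measure PointMeasure} [IsProbabilityMeasure ν]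

/-- Almost surely finitely many nodes are alive at `r`, so the products over `K` are eventually
constant as `K` grows; they are bounded by 1, and dominated convergence applies. -/
lemma integral_mul_character (h : HasSequenceLaw mY ν fun i y => y i)
    (hν : MalthusianHypotheses ν) (hF : NonExplosion ν) (hg : IsCharacter g)
    {α x r t : ℝ} (hα : 0 ≤ α) (hx : 0 < x) (hr : 0 ≤ r) (ht : 0 ≤ t) {Z : Noise → ℂ}
    (hZ : Measurable Z) (hZ1 : ∀ W, ‖Z W‖ ≤ 1)
    (hinv : ∀ u, ∀ W, IsGood W → Alive α x (ratios W) (clocks W) r u →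
      Z (freeze α x r u W) = Z W) :
    ∫ W, Z W * g (treeX α (t + r) x W) ∂treeLaw mY =
      ∫ W, Z W * ∫ s, g s ∂transition mY α t (treeX α r x W) ∂treeLaw mY := by
  have hgood := ae_isGood h
  have hborn := ae_finite_born h hν hF hα hx
  have hbd : ∀ {a b : ℂ}, ‖a‖ ≤ 1 → ‖b‖ ≤ 1 → ‖a * b‖ ≤ 1 := fun ha hb => by
    rw [norm_mul]; exact mul_le_one₀ ha (norm_nonneg _) hb
  have l₁ : Filter.Tendsto (fun K : Finset Node =>
      ∫ W, Z W * ∏ u ∈ K, charFactor g α x r t u W ∂treeLaw mY) Filter.atTop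
      (nhds (∫ W, Z W * g (treeX α (t + r) x W) ∂treeLaw mY)) := by
    refine tendsto_integral_filter_of_dominated_convergence (fun _ => 1)
      (.of_forall fun K => (hZ.mul (Finset.measurable_fun_prod _ fun v _ =>
        measurable_charFactor hg α x r t v)).aestronglyMeasurable)
      (.of_forall fun K => .of_forall fun W => hbd (hZ1 W)
        (norm_prod_le_one (norm_charFactor_le hg α x r t) K W)) (integrable_const _) ?_
    filter_upwards [hgood, hborn] with W hW hfin
    have hA := finite_alive (hfin r)
    refine tendsto_const_nhds.congr' ?_
    filter_upwards [Filter.eventually_ge_atTop hA.toFinset] with K hK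
    rw [prod_charFactor_eq hg hW hx.le hr ht (hfin _) hA hK]
  have l₂ : Filter.Tendsto (fun K : Finset Node =>
      ∫ W, Z W * ∏ u ∈ K, meanFactor mY g α x r t u W ∂treeLaw mY) Filter.atTop
      (nhds (∫ W, Z W * ∫ s, g s ∂transition mY α t (treeX α r x W) ∂treeLaw mY)) := by
    refine tendsto_integral_filter_of_dominated_convergence (fun _ => 1)
      (.of_forall fun K => (hZ.mul (Finset.measurable_fun_prod _ fun v _ =>
        measurable_meanFactor hg α x r t v)).aestronglyMeasurable)
      (.of_forall fun K => .of_forall fun W => hbd (hZ1 W)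
        (norm_prod_le_one (norm_meanFactor_le hg α x r t) K W)) (integrable_const _) ?_
    filter_upwards [hborn] with W hfin
    have hA := finite_alive (hfin r)
    refine tendsto_const_nhds.congr' ?_
    filter_upwards [Filter.eventually_ge_atTop hA.toFinset] with K hK
    rw [prod_meanFactor_eq hg hA hK]
  refine tendsto_nhds_unique l₁ (l₂.congr fun K => ?_)
  exact (integral_mul_prod_charFactor hgood hg hx.le K Z hZ hZ1 fun u _ => hinv u).symm

/-! ### The Markov property -/

/-- The path of the process until time `r`. -/
def pathUntil (α x : ℝ) (r : ℝ≥0) (W : Noise) : Set.Iic r → PointMeasure :=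
  fun r' => treeX α r'.1 x W

lemma measurable_pathUntil (α x : ℝ) (r : ℝ≥0) : Measurable (pathUntil α x r) :=
  measurable_pi_iff.2 fun _ => measurable_treeX_right α _ x

lemma pathUntil_freeze {α x : ℝ} {r : ℝ≥0} {W : Noise} (hW : IsGood W) (hx : 0 ≤ x) {u : Node}
    (hu : Alive α x (ratios W) (clocks W) r u) :
    pathUntil α x r (freeze α x r u W) = pathUntil α x r W := by
  funext r'
  rw [pathUntil, pathUntil, treeX, treeX, pop_freeze hW hx hu (NNReal.coe_le_coe.2 r'.2)]

/-- The Markov property on each event of the past, as an identity of finite measures. The indicator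
of such an event is invariant under freezing, hence an admissible `Z`. -/
lemma restrict_map_treeX_eq (h : HasSequenceLaw mY ν fun i y => y i)
    (hν : MalthusianHypotheses ν) (hF : NonExplosion ν) {α x : ℝ} {r t : ℝ≥0} (hα : 0 ≤ α)
    (hx : 0 < x) {D : Set (Set.Iic r → PointMeasure)} (hD : MeasurableSet D) :
    ((treeLaw mY).restrict (pathUntil α x r ⁻¹' D)).map (fun W => treeX α (t + r) x W) =
      transition mY α t ∘ₘ
        (((treeLaw mY).restrict (pathUntil α x r ⁻¹' D)).map fun W => treeX α r x W) := by
  have hD' : MeasurableSet (pathUntil α x r ⁻¹' D) := measurable_pathUntil α x r hD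
  refine ext_of_character fun g hg => ?_
  have hgm : Measurable fun s => ∫ s', g s' ∂transition mY α t s :=
    (hg.measurable.stronglyMeasurable.integral_kernel (κ := transition mY α t)).measurable
  have hint : Integrable g (transition mY α t ∘ₘ
        (((treeLaw mY).restrict (pathUntil α x r ⁻¹' D)).map fun W => treeX α r x W)) :=
    hg.integrable_comp measurable_id
  rw [integral_map (measurable_treeX_right α _ x).aemeasurable hg.measurable.aestronglyMeasurable]
  rw [Measure.comp_eq_comp_const_apply] at hint ⊢
  rw [Kernel.integral_comp hint, Kernel.const_apply,
    integral_map (measurable_treeX_right α _ x).aemeasurable hgm.aestronglyMeasurable,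
    ← integral_indicator hD', ← integral_indicator hD']
  have key := integral_mul_character h hν hF hg hα hx r.2 t.2
    (Z := (pathUntil α x r ⁻¹' D).indicator 1) (measurable_one.indicator hD')
    (fun W => (norm_indicator_le_norm_self _ W).trans (by simp)) (fun u W hW hu => by
      have : freeze α x r u W ∈ pathUntil α x r ⁻¹' D ↔ W ∈ pathUntil α x r ⁻¹' D := by
        rw [Set.mem_preimage, Set.mem_preimage, pathUntil_freeze hW hx.le hu]
      by_cases hWD : W ∈ pathUntil α x r ⁻¹' D
      · exact (Set.indicator_of_mem (this.2 hWD) _).trans (Set.indicator_of_mem hWD (1 : Noise → ℂ)).symm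
      · exact (Set.indicator_of_notMem (fun h => hWD (this.1 h)) _).trans
          (Set.indicator_of_notMem hWD (1 : Noise → ℂ)).symm)
  convert key using 2
  · funext W
    by_cases hWD : W ∈ pathUntil α x r ⁻¹' D <;> simp [Set.indicator, hWD]
  · funext W
    by_cases hWD : W ∈ pathUntil α x r ⁻¹' D <;> simp [Set.indicator, hWD]

end

section

/-! ### Scaling -/

lemma lifetime_scale {α c : ℝ} (hc : 0 < c) {W : Noise} (hW : IsGood W) (u : Node) :
    lifetime α c (ratios W) (clocks W) u = c ^ (-α) * lifetime α 1 (ratios W) (clocks W) u := by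
  rw [lifetime, lifetime, size_eq_mul c,
    Real.mul_rpow hc.le (size_nonneg zero_le_one hW.ratios_nonneg u), mul_assoc]

lemma birth_scale {α c : ℝ} (hc : 0 < c) {W : Noise} (hW : IsGood W) (u : Node) :
    birth α c (ratios W) (clocks W) u = c ^ (-α) * birth α 1 (ratios W) (clocks W) u := by
  induction u with
  | nil => simp [birth]
  | cons i u ih => rw [birth, birth, ih, lifetime_scale hc hW, mul_add]

lemma alive_scale {α c t : ℝ} (hc : 0 < c) {W : Noise} (hW : IsGood W) (u : Node) :
    Alive α c (ratios W) (clocks W) t u ↔ Alive α 1 (ratios W) (clocks W) (c ^ α * t) u := by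
  have hcα : 0 < c ^ α := Real.rpow_pos_of_pos hc α
  rw [Alive, Alive, birth_scale hc hW, lifetime_scale hc hW, size_eq_mul, mul_pos_iff_of_pos_left hc,
    ← mul_add, Real.rpow_neg hc.le, inv_mul_le_iff₀ hcα, lt_inv_mul_iff₀ hcα]

lemma coe_scale (c : PosReal) (s : PointMeasure) :
    (scale c s : Measure PosReal) = (s : Measure PosReal).map fun y => c * y := rfl

/-- The same noise drives both processes. Finiteness is needed because the default value 0 in
`toPointMeasure` must not intervene. -/
lemma scale_treeX {α t : ℝ} (c : PosReal) {W : Noise} (hW : IsGood W)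
    (hfin : {u | Alive α c (ratios W) (clocks W) t u}.Finite) :
    scale c (treeX α ((c : ℝ) ^ α * t) 1 W) = treeX α t c W := by
  classical
  have hfin' : {u | Alive α 1 (ratios W) (clocks W) ((c : ℝ) ^ α * t) u}.Finite :=
    hfin.subset fun u hu => (alive_scale c.2 hW u).2 hu
  have hm : Measurable fun y : PosReal => c * y :=
    (measurable_const.mul measurable_subtype_coe).subtype_mk
  refine Subtype.ext (Measure.ext fun B hB => ?_)
  rw [coe_scale, treeX, treeX, toPointMeasure_of_mem (pop_mem_pointMeasures hfin'),
    toPointMeasure_of_mem (pop_mem_pointMeasures hfin), Measure.map_apply hm hB,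
    pop_apply _ _ _ _ hB, pop_apply _ _ _ _ (hm hB)]
  refine tsum_congr fun u => ?_
  by_cases hu : Alive α c (ratios W) (clocks W) t u
  · have hu' := (alive_scale c.2 hW u).1 hu
    rw [if_pos hu, if_pos hu', Measure.dirac_apply' _ hB, Measure.dirac_apply' _ (hm hB)]
    have : toPos (size c (ratios W) u) = c * toPos (size 1 (ratios W) u) := by
      refine Subtype.ext ?_
      rw [toPos_of_pos hu.1, toPos_of_pos hu'.1]
      exact size_eq_mul _ _ _
    rw [this]
    rfl
  · rw [if_neg hu, if_neg fun h => hu ((alive_scale c.2 hW u).2 h)]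

/-! ### Transfer from the canonical space -/

/-- The noise built from the families `Y` and `E`. -/
def noise {Ω : Type*} (Y : Node → ℕ → Ω → ℝ) (E : Node → Ω → ℝ) (ω : Ω) : Noise :=
  fun u => (fun i => Y u i ω, E u ω)

lemma naturalSigma_eq_comap {Ω : Type*} {Y : Node → ℕ → Ω → ℝ} {E : Node → Ω → ℝ} (α : ℝ) (x : PosReal) (r : ℝ≥0) :
    naturalSigma α Y E x r =
      MeasurableSpace.comap (fun ω => pathUntil α x r (noise Y E ω)) inferInstance := by
  have : (inferInstance : MeasurableSpace (Set.Iic r → PointMeasure)) =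
      ⨆ r' : Set.Iic r, MeasurableSpace.comap (fun f => f r') inferInstance := rfl
  rw [this, MeasurableSpace.comap_iSup, naturalSigma]
  refine iSup_congr fun r' => ?_
  rw [MeasurableSpace.comap_comp]
  rfl

lemma X_add_eq {Ω : Type*} {Y : Node → ℕ → Ω → ℝ} {E : Node → Ω → ℝ} (α : ℝ) (x : PosReal) (t r : ℝ≥0) :
    X α Y E x (t + r) = fun ω => treeX α ((t : ℝ) + r) x (noise Y E ω) := by
  funext ω
  rw [← NNReal.coe_add]
  rfl

variable {Ω : Type*} [MeasurableSpace Ω] {P : Measure Ω} {ν : Measure PointMeasure}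
  {Y : Node → ℕ → Ω → ℝ} {E : Node → Ω → ℝ}

/-- The law of the sequence of ratios at a node. -/
def ratioLaw (P : Measure Ω) (Y : Node → ℕ → Ω → ℝ) : Measure (ℕ → ℝ) :=
  P.map fun ω i => Y [] i ω

lemma measurable_noise (h : IsTreeNoise P ν Y E) : Measurable (noise Y E) :=
  measurable_pi_iff.2 fun u =>
    (measurable_pi_iff.2 (h.measurable_offspring u)).prodMk (h.measurable_clock u)

lemma isProbabilityMeasure_ratioLaw [IsProbabilityMeasure P] (h : IsTreeNoise P ν Y E) :
    IsProbabilityMeasure (ratioLaw P Y) :=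
  Measure.isProbabilityMeasure_map (measurable_pi_iff.2 (h.measurable_offspring [])).aemeasurable

lemma map_noise [IsProbabilityMeasure P] (h : IsTreeNoise P ν Y E) : P.map (noise Y E) = treeLaw (ratioLaw P Y) := by
  have hY : ∀ u, Measurable fun ω i => Y u i ω := fun u =>
    measurable_pi_iff.2 (h.measurable_offspring u)
  have hind := iIndepFun_prodMk hY h.measurable_clock h.offspring_indep h.clock_indep
    h.offspring_indep_clock
  have h1 := hind.map_fun_eq_infinitePi_map fun u => (hY u).prodMk (h.measurable_clock u)
  refine h1.trans ?_
  unfold treeLaw noiseLaw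
  congr 1
  funext u
  have h2 : IndepFun (fun ω i => Y u i ω) (E u) P :=
    h.offspring_indep_clock.comp (φ := fun y : Node → ℕ → ℝ => y u) (ψ := fun e : Node → ℝ => e u)
      (measurable_pi_apply u) (measurable_pi_apply u)
  rw [h2.map_prod_eq_prod_map_map (hY u).aemeasurable (h.measurable_clock u).aemeasurable,
    h.clock_law u, (h.offspring_identDistrib u []).map_eq, ratioLaw]

lemma hasSequenceLaw_ratioLaw (h : IsTreeNoise P ν Y E) :
    HasSequenceLaw (ratioLaw P Y) ν fun i y => y i := by
  have hY : Measurable fun ω i => Y [] i ω := measurable_pi_iff.2 (h.measurable_offspring [])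
  obtain ⟨h1, h2⟩ := h.offspring_law []
  refine ⟨?_, ?_⟩
  -- Measurability of this set allows the almost sure statement to pass to the image law.
  · have hS : MeasurableSet {y : ℕ → ℝ | ∃ n : ℕ, ∀ i, 0 ≤ y i ∧ (y i = 0 ↔ n ≤ i)} := by
      simp only [Set.ofPred_exists, Set.ofPred_forall]
      refine .iUnion fun n => .iInter fun i => ?_
      refine (measurableSet_le measurable_const (measurable_pi_apply i)).inter ?_
      have h0 : MeasurableSet {y : ℕ → ℝ | y i = 0} :=
        measurable_pi_apply i (measurableSet_singleton 0)
      by_cases hn : n ≤ i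
      · simp only [hn, iff_true]
        exact h0
      · simp only [hn, iff_false]
        exact h0.compl
    exact (ae_map_iff hY.aemeasurable hS).2 h1
  · rw [ratioLaw, Measure.map_map measurable_offspring_measure hY]
    exact h2

lemma ae_noise [IsProbabilityMeasure P] (h : IsTreeNoise P ν Y E) {p : Noise → Prop}
    (hp : ∀ᵐ W ∂treeLaw (ratioLaw P Y), p W) : ∀ᵐ ω ∂P, p (noise Y E ω) := by
  rw [← map_noise h] at hp
  exact ae_of_ae_map (measurable_noise h).aemeasurable hp

lemma measurable_X (h : IsTreeNoise P ν Y E) (α : ℝ) (x : PosReal) (t : ℝ≥0) :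
    Measurable (X α Y E x t) :=
  Measurable.comp (g := fun W => treeX α t x W) (f := noise Y E) (measurable_treeX_right α t x)
    (measurable_noise h)

lemma condExp_X_eq [IsProbabilityMeasure P] [IsProbabilityMeasure ν] (h : IsTreeNoise P ν Y E)
    (hν : MalthusianHypotheses ν) (hF : NonExplosion ν) {α : ℝ} (hα : 0 ≤ α)
    [IsProbabilityMeasure (ratioLaw P Y)] (x : PosReal) (r t : ℝ≥0) {B : Set PointMeasure}
    (hB : MeasurableSet B) :
    P⟦X α Y E x (t + r) ⁻¹' B | naturalSigma α Y E x r⟧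
      =ᵐ[P] fun ω => (transition (ratioLaw P Y) α t (X α Y E x r ω)).real B := by
  have hΦ := measurable_noise h
  have hm : naturalSigma α Y E x r ≤ ‹MeasurableSpace Ω› := by
    rw [naturalSigma_eq_comap]
    exact ((measurable_pathUntil α x r).comp hΦ).comap_le
  have hX : Measurable (X α Y E x (t + r)) := measurable_X h α x (t + r)
  have hXr : Measurable[naturalSigma α Y E x r] (X α Y E x r) := by
    refine Measurable.of_comap_le ?_
    exact le_iSup (fun r' : Set.Iic r => MeasurableSpace.comap (X α Y E x r') inferInstance)
      ⟨r, Set.mem_Iic.2 le_rfl⟩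
  have hQ : Measurable fun s => (transition (ratioLaw P Y) α t s).real B :=
    (Kernel.measurable_coe _ hB).ennreal_toReal
  refine (ae_eq_condExp_of_forall_setIntegral_eq hm ?_ (fun s _ _ => ?_) (fun s hs _ => ?_) ?_).symm
  · exact (integrable_const (1 : ℝ)).indicator (hX hB)
  · refine Integrable.of_bound ((hQ.comp (hXr.mono hm le_rfl)).aestronglyMeasurable) 1
      (.of_forall fun ω => ?_)
    rw [Real.norm_of_nonneg measureReal_nonneg]
    exact measureReal_le_one
  -- Every event of the past is the preimage of a set `D` of paths up to time `r`.
  · rw [naturalSigma_eq_comap] at hs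
    obtain ⟨D, hD, rfl⟩ := hs
    have hD' := measurable_pathUntil α x r hD
    have key := congrArg (fun μ => μ B)
      (restrict_map_treeX_eq (hasSequenceLaw_ratioLaw h) hν hF hα x.2 (r := r) (t := t) hD)
    beta_reduce at key
    rw [Measure.map_apply (measurable_treeX_right α _ x) hB,
      Measure.bind_apply hB (Kernel.aemeasurable _),
      lintegral_map (Kernel.measurable_coe _ hB) (measurable_treeX_right α _ x),
      Measure.restrict_apply (measurable_treeX_right α _ x hB)] at key
    have e1 : ∫ ω in (fun ω => pathUntil α x r (noise Y E ω)) ⁻¹' D,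
        (transition (ratioLaw P Y) α t (X α Y E x r ω)).real B ∂P =
        ∫ W in pathUntil α x r ⁻¹' D,
          (transition (ratioLaw P Y) α t (treeX α r x W)).real B ∂treeLaw (ratioLaw P Y) := by
      have hQX : Measurable fun W =>
          (transition (ratioLaw P Y) α t (treeX α r x W)).real B :=
        hQ.comp (measurable_treeX_right α r x)
      rw [← map_noise h, setIntegral_map hD' hQX.aestronglyMeasurable hΦ.aemeasurable]
      rfl
    rw [e1, integral_indicator (hX hB), Measure.restrict_restrict (hX hB), integral_const,
      smul_eq_mul, mul_one, measureReal_def, Measure.restrict_apply_univ]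
    have e2 : X α Y E x (t + r) ⁻¹' B ∩ (fun ω => pathUntil α x r (noise Y E ω)) ⁻¹' D =
        noise Y E ⁻¹' ((fun W => treeX α (t + r) x W) ⁻¹' B ∩ pathUntil α x r ⁻¹' D) := by
      rw [X_add_eq]
      rfl
    rw [e2, ← Measure.map_apply hΦ ((measurable_treeX_right α _ x hB).inter hD'), map_noise h, key]
    exact integral_toReal ((Kernel.measurable_coe _ hB).comp
      (measurable_treeX_right α _ x)).aemeasurable (.of_forall fun W => measure_lt_top _ _)
  · exact (hQ.comp hXr).aestronglyMeasurable

end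

end SelfSimilarBranching

end

/-! ### The main theorem -/

open SelfSimilarBranching in
theorem mainTheorem3 {Ω : Type*} [MeasurableSpace Ω] (P : Measure Ω) [IsProbabilityMeasure P]
    (α : ℝ) (hα : 0 ≤ α)
    (ν : Measure PointMeasure) [IsProbabilityMeasure ν]
    (hν : MalthusianHypotheses ν) (hF : NonExplosion ν)
    (Y : Node → ℕ → Ω → ℝ) (E : Node → Ω → ℝ) (hYE : IsTreeNoise P ν Y E) :
    -- the process takes its values in the set of finite point measures
    (∀ x : PosReal, (∀ t : ℝ≥0, Measurable (X α Y E x t)) ∧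
      ∀ᵐ ω ∂P, ∀ t : ℝ≥0,
        population α x (fun u i => Y u i ω) (fun u => E u ω) t ∈ pointMeasures) ∧
    -- it is a branching Markov chain
    (∀ t : ℝ≥0, ∃ Q : Kernel PointMeasure PointMeasure, IsMarkovKernel Q ∧
      (∀ (n : ℕ) (s : Fin n → PosReal),
        Q (∑ i, atom (s i)) =
          (Measure.pi fun i => P.map (X α Y E (s i) t)).map
            (fun y : Fin n → PointMeasure => ∑ i, y i)) ∧
      ∀ (x : PosReal) (r : ℝ≥0) (B : Set PointMeasure), MeasurableSet B →
        P⟦X α Y E x (t + r) ⁻¹' B | naturalSigma α Y E x r⟧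
          =ᵐ[P] fun ω => (Q (X α Y E x r ω)).real B) ∧
    -- it has the scaling property
    (∀ c : PosReal,
      P.map (fun ω (t : ℝ≥0) => scale c (X α Y E 1 (Real.toNNReal ((c : ℝ) ^ α) * t) ω)) =
        P.map (fun ω (t : ℝ≥0) => X α Y E c t ω)) := by
  have hprob := isProbabilityMeasure_ratioLaw hYE
  have hseq := hasSequenceLaw_ratioLaw hYE
  have hΦ := measurable_noise hYE
  have hX : ∀ (x : PosReal) (t : ℝ≥0), Measurable (X α Y E x t) := fun x t => measurable_X hYE α x t
  refine ⟨fun x => ⟨hX x, ?_⟩, fun t => ⟨transition (ratioLaw P Y) α t, inferInstance, ?_, ?_⟩, ?_⟩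
  · filter_upwards [ae_noise hYE (ae_finite_born hseq hν hF hα x.2)] with ω hω t
    exact pop_mem_pointMeasures (W := noise Y E ω) (finite_alive (hω t))
  · intro n s
    rw [transition_sum_atom]
    congr 2
    funext i
    rw [← map_noise hYE, Measure.map_map (measurable_treeX_right α t (s i)) hΦ]
    rfl
  · intro x r B hB
    exact condExp_X_eq hYE hν hF hα x r t hB
  · intro c
    -- The two processes agree almost surely at all times simultaneously, which is more than
    -- equality of laws.
    refine Measure.map_congr ?_
    filter_upwards [ae_noise hYE (ae_isGood hseq),
      ae_noise hYE (ae_finite_born hseq hν hF hα c.2)] with ω hgood hfin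
    funext t
    have h1 := scale_treeX (α := α) (t := t) c hgood (finite_alive (hfin t))
    have h2 : ((Real.toNNReal ((c : ℝ) ^ α) * t : ℝ≥0) : ℝ) = (c : ℝ) ^ α * t := by
      rw [NNReal.coe_mul, Real.coe_toNNReal _ (Real.rpow_nonneg c.2.le _)]
    rw [← h2] at h1
    exact h1
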